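/- All graphs are finite and connected; loops and parallel edges are allowed. Cocycles are inclusion-minimal nonempty cuts, cycles are edge sets of simple closed walks, and both are signed according to edge directions. For a spanning tree $T$, the fundamental cocycle $C^*(T;t)$ of $t\in T$ (the cocycle contained in $(E\setminus T)\cup\{t\}$) is signed so that $t$ is positive, and the fundamental cycle $C(T;e)$ of $e\notin T$ (the cycle contained in $T\cup\{e\}$) is signed so that $e$ is positive. For a set $A$ of edges, $G(A)$ is $G$ with its edges restricted to $A$. Let $\vec G=(V,E)$ be a digraph on a linearly ordered edge set that is bipolar with respect to $p=\min(E)$: it is acyclic and has a unique source and a unique sink, which are the extremities of $p$. Let $r=|V|-1$. The fully optimal spanning tree $\alpha(\vec G)$ is the unique spanning tree $T$ such that $\min C^*(T;b)$ is negative in $C^*(T;b)$ for all $b\in T\setminus\{p\}$, and $\min C(T;e)$ is negative in $C(T;e)$ for all $e\in E\setminus T$. An optimizable digraph is a connected digraph $\vec H$ with edge set $E_H\cup F_H$ (possibly $E_H\cap F_H\neq\emptyset$), where $F_H$ is linearly ordered, together with an edge $p_H\in E_H\setminus F_H$, such that $\vec H(E_H)$ is acyclic and $F_H\cup\{p_H\}$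 is a spanning tree of $H$. For signed cocycles $C,D$ of $\vec H$ containing $p_H$, put $C>D$ if, at the smallest $f\in F_H$ whose signs in $C$ and $D$ differ, the sign in $C$ is larger than the sign in $D$, where negative $<$ absent $<$ positive. The optimal cocycle of $\vec H$ is the largest signed cocycle $C$ that contains $p_H$ positively and such that $C\cap E_H$ is a cocycle of $H(E_H)$ all of whose elements are positive in $C$. Algorithm. Start with $\vec G_1=\vec G$, $t_1=p$, $E_1=E$ and $F_1=B\setminus\{p\}$, where $B$ is the lexicographically smallest spanning tree of $\vec G$; all sets $F_i$ are ordered as subsets of $E$. For $i=2,\dots,r$: let $C_{i-1}$ be the optimal cocycle of $\vec G_{i-1}$ (with infinity edge $t_{i-1}$, ground set $E_{i-1}$, objective set $F_{i-1}$); let $E_i=E_{i-1}\setminus C_{i-1}$ and $t_i=\min(E_i)$; let $F_i=F_{i-1}\setminus\{t_i\}$ if $t_i\in F_{i-1}$, and otherwise let $F_i=F_{i-1}\setminus\{\max(F_{i-1}\cap Z)\}$, where $Z$ is the fundamental cycle of $t_i$ with respect to the spanning tree $F_{i-1}\cup\{t_{i-1}\}$ of $G_{i-1}$; let $\vec G_i=\vec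 G_{i-1}(E_i\cup F_i\cup\{t_{i-1}\})/\{t_{i-1}\}$, with infinity edge $t_i$, ground set $E_i$ and objective set $F_i$. Output $\{t_1,\dots,t_r\}$. Theorem. The tree $\alpha(\vec G)$ exists and is unique; the algorithm is well defined (every $\vec G_i$ is an optimizable digraph, every optimal cocycle used exists and is unique, and all the minima and maxima used exist); $t_1<t_2<\dots<t_r$; and $\alpha(\vec G)=\{t_1,\dots,t_r\}$. Moreover: - for $1\le i<r$, $C_i$ is the signed cocycle induced in $\vec G_i$ by $C^*(\alpha(\vec G);t_i)$, that is, its positive (negative) part is the intersection of the positive (negative) part of $C^*(\alpha(\vec G);t_i)$ with $E_i\cup F_i$; - for $2\le i\le r$, $t_i=\min\bigl(E\setminus\bigcup_{j<i}C^*(\alpha(\vec G);t_j)\bigr)$; - for $1\le i<r$, $F_{i+1}=F_i\setminus\{m\}$, where $m$ is the greatest element of $F_i$ such that $t_{i+1}\notin F_i\setminus\{m\}$ and $(F_i\setminus\{m\})\cup\{t_{i+1}\}$ is a spanning tree of $G_i(E_{i+1}\cup(F_i\setminus\{m\})\cup\{t_i\})/\{t_i\}$. -/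

import Mathlib

/-- A finite directed multigraph: loops and parallel edges are allowed. The maps `src` and `tgt`
are meaningful on `edges` only. -/
structure MultiDigraph (V E : Type*) where
  verts : Finset V
  edges : Finset E
  src : E → V
  tgt : E → V
  src_mem : ∀ e ∈ edges, src e ∈ verts
  tgt_mem : ∀ e ∈ edges, tgt e ∈ verts

/-- A signed edge subset: a positive part and a disjoint negative part. -/
@[ext]
structure SignedEdgeSet (E : Type*) where
  pos : Finset E
  neg : Finset E
  disj : Disjoint pos neg

/-- The underlying unsigned edge subset. -/
def SignedEdgeSet.supp {E : Type*} [DecidableEq E] (C : SignedEdgeSet E) : Finset E :=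
  C.pos ∪ C.neg

/-- The sign of an edge: `1` if positive, `-1` if negative, `0` if it is not an element. -/
def SignedEdgeSet.sign {E : Type*} [DecidableEq E] (C : SignedEdgeSet E) (e : E) : ℤ :=
  if e ∈ C.pos then 1 else if e ∈ C.neg then -1 else 0

namespace MultiDigraph

/-- The digraph `G(A)`: keep all vertices and only the edges that belong to `A`. -/
def restrict {V E : Type*} [DecidableEq E] (G : MultiDigraph V E) (A : Finset E) :
    MultiDigraph V E where
  verts := G.verts
  edges := G.edges ∩ A
  src := G.src
  tgt := G.tgt
  src_mem e he := G.src_mem e (Finset.mem_inter.1 he).1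
  tgt_mem e he := G.tgt_mem e (Finset.mem_inter.1 he).1

open Classical in
/-- The map on vertices that identifies the head of `p` with its tail. -/
noncomputable def glue {V E : Type*} (G : MultiDigraph V E) (p : E) (v : V) : V :=
  if v = G.tgt p then G.src p else v

open Classical in
/-- The contraction `G / {p}`: identify the two extremities of `p` and remove the edge `p`. -/
noncomputable def contract {V E : Type*} [DecidableEq E] (G : MultiDigraph V E) (p : E) :
    MultiDigraph V E where
  verts := G.verts.image (G.glue p)
  edges := G.edges.erase p
  src e := G.glue p (G.src e)
  tgt e := G.glue p (G.tgt e)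
  src_mem e he := Finset.mem_image_of_mem _ (G.src_mem e (Finset.mem_of_mem_erase he))
  tgt_mem e he := Finset.mem_image_of_mem _ (G.tgt_mem e (Finset.mem_of_mem_erase he))

/-- Tail of an edge traversed forwards (`true`) or backwards (`false`). -/
def dartStart {V E : Type*} (G : MultiDigraph V E) (d : E × Bool) : V :=
  if d.2 then G.src d.1 else G.tgt d.1

/-- Head of an edge traversed forwards (`true`) or backwards (`false`). -/
def dartEnd {V E : Type*} (G : MultiDigraph V E) (d : E × Bool) : V :=
  if d.2 then G.tgt d.1 else G.src d.1

/-- `G.IsWalk u l v`: the list `l` of traversed edges is a walk of the underlying undirected graph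
from `u` to `v`. -/
def IsWalk {V E : Type*} (G : MultiDigraph V E) : V → List (E × Bool) → V → Prop
  | u, [], v => u = v
  | u, d :: l, v => d.1 ∈ G.edges ∧ G.dartStart d = u ∧ G.IsWalk (G.dartEnd d) l v

/-- The underlying undirected graph is connected (and has a vertex). -/
def Connected {V E : Type*} (G : MultiDigraph V E) : Prop :=
  G.verts.Nonempty ∧ ∀ u ∈ G.verts, ∀ v ∈ G.verts, ∃ l, G.IsWalk u l v

/-- Signed cycles: the edges of a closed walk of positive length that repeats neither vertices nor
edges, the edges traversed forwards being positive and the edges traversed backwards negative. -/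
def IsSignedCycle {V E : Type*} (G : MultiDigraph V E) (C : SignedEdgeSet E) : Prop :=
  ∃ (u : V) (l : List (E × Bool)), l ≠ [] ∧ G.IsWalk u l u ∧ (l.map G.dartStart).Nodup ∧
    (l.map Prod.fst).Nodup ∧
    ∀ e, (e ∈ C.pos ↔ (e, true) ∈ l) ∧ (e ∈ C.neg ↔ (e, false) ∈ l)

/-- There is no directed cycle. -/
def Acyclic {V E : Type*} (G : MultiDigraph V E) : Prop :=
  ¬ ∃ C : SignedEdgeSet E, G.IsSignedCycle C ∧ C.neg = ∅

open Classical in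
/-- The edges of `G` directed from `S` to its complement. -/
noncomputable def cutOut {V E : Type*} (G : MultiDigraph V E) (S : Set V) : Finset E :=
  G.edges.filter fun e => G.src e ∈ S ∧ G.tgt e ∉ S

open Classical in
/-- The edges of `G` directed from the complement of `S` to `S`. -/
noncomputable def cutIn {V E : Type*} (G : MultiDigraph V E) (S : Set V) : Finset E :=
  G.edges.filter fun e => G.src e ∉ S ∧ G.tgt e ∈ S

/-- Cocycles: the inclusion-minimal nonempty cuts. -/
def IsCocycle {V E : Type*} [DecidableEq E] (G : MultiDigraph V E) (D : Finset E) : Prop :=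
  Minimal (fun D : Finset E => D.Nonempty ∧ ∃ S : Set V, D = G.cutOut S ∪ G.cutIn S) D

/-- Signed cocycles: a cocycle with its elements signed according to their direction with respect
to the vertex bipartition. -/
def IsSignedCocycle {V E : Type*} [DecidableEq E] (G : MultiDigraph V E)
    (C : SignedEdgeSet E) : Prop :=
  G.IsCocycle C.supp ∧ ∃ S : Set V, C.pos = G.cutOut S ∧ C.neg = G.cutIn S

/-- Spanning trees, as sets of edges: connected on all vertices, and without (undirected) cycle. -/
def IsSpanningTree {V E : Type*} [DecidableEq E] (G : MultiDigraph V E) (T : Finset E) : Prop :=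
  T ⊆ G.edges ∧ (G.restrict T).Connected ∧
    ¬ ∃ C : SignedEdgeSet E, G.IsSignedCycle C ∧ C.supp ⊆ T

/-- `C` is the signed fundamental cocycle `C*(T; t)` of `t ∈ T`, in which `t` is positive. -/
def IsFundCocycle {V E : Type*} [DecidableEq E] (G : MultiDigraph V E) (T : Finset E) (t : E)
    (C : SignedEdgeSet E) : Prop :=
  G.IsSignedCocycle C ∧ t ∈ C.pos ∧ C.supp ⊆ insert t (G.edges \ T)

/-- `C` is the signed fundamental cycle `C(T; e)` of `e ∉ T`, in which `e` is positive. -/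
def IsFundCycle {V E : Type*} [DecidableEq E] (G : MultiDigraph V E) (T : Finset E) (e : E)
    (C : SignedEdgeSet E) : Prop :=
  G.IsSignedCycle C ∧ e ∈ C.pos ∧ C.supp ⊆ insert e T

/-- `G` is bipolar with respect to the edge `p`: it is connected and acyclic, it has a unique
source and a unique sink, and these are the extremities of `p`. -/
def IsBipolar {V E : Type*} (G : MultiDigraph V E) (p : E) : Prop :=
  G.Connected ∧ G.Acyclic ∧ p ∈ G.edges ∧
    (∀ v ∈ G.verts, (∀ e ∈ G.edges, G.tgt e ≠ v) ↔ v = G.src p) ∧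
    (∀ v ∈ G.verts, (∀ e ∈ G.edges, G.src e ≠ v) ↔ v = G.tgt p)

/-- The full optimality criterion for `T`, with `p` the smallest edge of `G`. -/
def IsFullyOptimal {V E : Type*} [LinearOrder E] (G : MultiDigraph V E) (p : E)
    (T : Finset E) : Prop :=
  G.IsSpanningTree T ∧
    (∀ b ∈ T, b ≠ p →
      ∃ C, G.IsFundCocycle T b C ∧ ∃ a, IsLeast (C.supp : Set E) a ∧ a ∈ C.neg) ∧
    (∀ e ∈ G.edges, e ∉ T →
      ∃ C, G.IsFundCycle T e C ∧ ∃ a, IsLeast (C.supp : Set E) a ∧ a ∈ C.neg)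

/-- `T` is the lexicographically smallest spanning tree: at the first place where `T` and another
spanning tree differ, the smaller edge is in `T`. -/
def IsLexMinSpanningTree {V E : Type*} [LinearOrder E] (G : MultiDigraph V E)
    (T : Finset E) : Prop :=
  G.IsSpanningTree T ∧
    ∀ T', G.IsSpanningTree T' → T' ≠ T → ∃ e ∈ T \ T', ∀ f ∈ T' \ T, e < f

end MultiDigraph

/-- Optimizable digraphs. The linear order on the objective set is the one of the type `E`. -/
structure OptimizableDigraph (V E : Type*) [LinearOrder E] where
  graph : MultiDigraph V E
  /-- the infinity edge -/
  inf : E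
  ground : Finset E
  obj : Finset E
  edges_eq : graph.edges = ground ∪ obj
  connected : graph.Connected
  inf_mem : inf ∈ ground \ obj
  acyclic : (graph.restrict ground).Acyclic
  spanning : graph.IsSpanningTree (insert inf obj)

namespace OptimizableDigraph

/-- The linear order `C < D` on signed cocycles: the smallest edge of the objective set at which
the signs of `C` and `D` differ has the larger sign in `D` (negative < absent < positive). -/
def CocycleLT {V E : Type*} [LinearOrder E] (S : OptimizableDigraph V E)
    (C D : SignedEdgeSet E) : Prop :=
  ∃ f ∈ S.obj, C.sign f < D.sign f ∧ ∀ g ∈ S.obj, g < f → C.sign g = D.sign g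

/-- `C` is a signed cocycle containing the infinity edge with positive sign and inducing a directed
cocycle of the digraph restricted to the ground set. -/
def IsFeasible {V E : Type*} [LinearOrder E] (S : OptimizableDigraph V E)
    (C : SignedEdgeSet E) : Prop :=
  S.graph.IsSignedCocycle C ∧ S.inf ∈ C.pos ∧
    (S.graph.restrict S.ground).IsCocycle (C.supp ∩ S.ground) ∧ C.supp ∩ S.ground ⊆ C.pos

/-- `C` is the optimal cocycle: it is feasible and larger than every other feasible one. -/
def IsOptimalCocycle {V E : Type*} [LinearOrder E] (S : OptimizableDigraph V E)
    (C : SignedEdgeSet E) : Prop :=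
  S.IsFeasible C ∧ ∀ D, S.IsFeasible D → D ≠ C → S.CocycleLT D C

/-- The minor `G(E' ∪ F' ∪ {p}) / {p}`. -/
noncomputable def nextGraph {V E : Type*} [LinearOrder E] (S : OptimizableDigraph V E)
    (E' F' : Finset E) : MultiDigraph V E :=
  (S.graph.restrict (E' ∪ F' ∪ {S.inf})).contract S.inf

/-- `S` is the optimizable digraph that initializes the algorithm on `G` with smallest edge `p`. -/
def IsInitial {V E : Type*} [LinearOrder E] (S : OptimizableDigraph V E) (G : MultiDigraph V E)
    (p : E) : Prop :=
  S.graph = G ∧ S.inf = p ∧ S.ground = G.edges ∧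
    ∃ B, G.IsLexMinSpanningTree B ∧ p ∈ B ∧ S.obj = B.erase p

/-- `S'` is obtained from `S` by one pass through the loop of the algorithm, `C` being the optimal
cocycle used in this pass. The new element of the output is `S'.inf`. -/
def IsStep {V E : Type*} [LinearOrder E] (S : OptimizableDigraph V E) (C : SignedEdgeSet E)
    (S' : OptimizableDigraph V E) : Prop :=
  S.IsOptimalCocycle C ∧
    IsLeast (↑(S.ground \ C.supp) : Set E) S'.inf ∧
    S'.ground = S.ground \ C.supp ∧
    (S'.inf ∈ S.obj → S'.obj = S.obj.erase S'.inf) ∧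
    (S'.inf ∉ S.obj → ∃ D, S.graph.IsFundCycle (insert S.inf S.obj) S'.inf D ∧
      ∃ m, IsGreatest (↑(S.obj ∩ D.supp) : Set E) m ∧ S'.obj = S.obj.erase m) ∧
    S'.graph = S.nextGraph S'.ground S'.obj

/-- `S 1, …, S r` are the successive optimizable digraphs of the algorithm on `G` (whose vertices
number `r + 1`), and `C 1, …, C (r - 1)` are the optimal cocycles used. The output is the set of
the edges `t i = (S i).inf` for `1 ≤ i ≤ r`, where `t 1 = p`. -/
def IsRun {V E : Type*} [LinearOrder E] (G : MultiDigraph V E) (p : E) (r : ℕ)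
    (S : ℕ → OptimizableDigraph V E) (C : ℕ → SignedEdgeSet E) : Prop :=
  (S 1).IsInitial G p ∧ ∀ i, 1 ≤ i → i < r → (S i).IsStep (C i) (S (i + 1))

end OptimizableDigraph

/-! The argument takes place in the space of tensions, which is orthogonal to all signed cycles. A
spanning tree T yields tensions x_b (b ∈ T), dual to its edges: x_b records the fundamental cocycle
of b, and for a fixed e outside T the values x_b(e) record, up to sign, the fundamental cycle of e.
Full optimality then says two things (`IsOptimalDual`): for b ≠ p the first nonzero value of x_b is
-1; for every edge e, the smallest b with x_b(e) ≠ 0 satisfies b ≤ e and x_b(e) = 1.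

Existence is linear programming (`IsBipolar.exists_isFullyOptimal`). Take weights w and lower bounds
δ that behave lexicographically, and maximize the w-weight over tensions x ≥ δ with x(p) = 1. The
tight edges of a maximizer form a spanning tree: genericity of δ forbids cycles and genericity of w
forces connectedness. Optimality gives the cocycle condition and feasibility the cycle condition.

For the algorithm, the invariant at t ∈ T (`IsStateAt`) is this: the tensions of the current minor
are those of G that vanish on the tree edges below t; the ground set consists of the edges where all
x_b with b < t vanish; the objective set consists of the leading positions ("pivots") of the
tensions vanishing on the tree edges up to t. By the condition on edges, t is the least ground edge
and x_t is nonnegative on the ground set. Any other feasible cocycle differs from x_t by a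
nonnegative combination of tensions x_b with b > t, each starting with -1, so the difference starts
negatively, and it does so at a pivot. Hence x_t is the optimal cocycle
(`IsStateAt.isOptimalCocycle_signedCut`), removing it exposes the successor of t in T, and requiring
tensions to vanish there costs exactly one pivot (`IsExchange.pivots_insert`). Uniqueness follows,
since a run depends on G alone while its output is every fully optimal tree (`IsRun.eq_image`). -/

namespace SignedEdgeSet

variable {E : Type*} [DecidableEq E]

theorem sign_of_mem_pos {C : SignedEdgeSet E} {e : E} (h : e ∈ C.pos) : C.sign e = 1 := by
  simp [sign, h]

theorem sign_of_mem_neg {C : SignedEdgeSet E} {e : E} (h : e ∈ C.neg) : C.sign e = -1 := by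
  have : e ∉ C.pos := fun h' => Finset.disjoint_left.1 C.disj h' h
  simp [sign, h, this]

theorem sign_eq_zero_iff {C : SignedEdgeSet E} {e : E} : C.sign e = 0 ↔ e ∉ C.supp := by
  unfold sign supp
  split_ifs <;> simp_all

theorem sign_eq_one_iff {C : SignedEdgeSet E} {e : E} : C.sign e = 1 ↔ e ∈ C.pos := by
  unfold sign
  split_ifs <;> simp_all

theorem sign_eq_neg_one_iff {C : SignedEdgeSet E} {e : E} : C.sign e = -1 ↔ e ∈ C.neg := by
  refine ⟨fun h => ?_, sign_of_mem_neg⟩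
  unfold sign at h
  split_ifs at h; simp_all

theorem abs_sign_le_one (C : SignedEdgeSet E) (e : E) : |(C.sign e : ℝ)| ≤ 1 := by
  unfold sign
  split_ifs <;> simp

theorem ext_sign {C D : SignedEdgeSet E} (h : ∀ e, C.sign e = D.sign e) : C = D := by
  ext e
  · rw [← sign_eq_one_iff, ← sign_eq_one_iff, h]
  · rw [← sign_eq_neg_one_iff, ← sign_eq_neg_one_iff, h]

end SignedEdgeSet

namespace MultiDigraph

/-! ### Walks, paths and closing paths into cycles -/

section Walks

variable {V E : Type*} {G H : MultiDigraph V E}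

theorem IsWalk.append {l₁ l₂ : List (E × Bool)} {u v w : V} (h₁ : G.IsWalk u l₁ v)
    (h₂ : G.IsWalk v l₂ w) : G.IsWalk u (l₁ ++ l₂) w := by
  induction l₁ generalizing u with
  | nil => cases h₁; exact h₂
  | cons d l ih => exact ⟨h₁.1, h₁.2.1, ih h₁.2.2⟩

theorem IsWalk.of_append {l₁ l₂ : List (E × Bool)} {u w : V} (h : G.IsWalk u (l₁ ++ l₂) w) :
    ∃ v, G.IsWalk u l₁ v ∧ G.IsWalk v l₂ w := by
  induction l₁ generalizing u with
  | nil => exact ⟨u, rfl, h⟩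
  | cons d l ih =>
    obtain ⟨v, hv, hw⟩ := ih h.2.2
    exact ⟨v, ⟨h.1, h.2.1, hv⟩, hw⟩

theorem IsWalk.mem_edges {l : List (E × Bool)} {u v : V} (h : G.IsWalk u l v) :
    ∀ d ∈ l, d.1 ∈ G.edges := by
  induction l generalizing u with
  | nil => simp
  | cons d l ih =>
    intro d' hd'
    rcases List.mem_cons.1 hd' with rfl | hd'
    · exact h.1
    · exact ih h.2.2 d' hd'

theorem IsWalk.dartEnd_mem {l : List (E × Bool)} {u v : V} (h : G.IsWalk u l v) :
    ∀ d ∈ l, G.dartEnd d = v ∨ G.dartEnd d ∈ l.map G.dartStart := by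
  induction l generalizing u with
  | nil => simp
  | cons d l ih =>
    intro d' hd'
    rcases List.mem_cons.1 hd' with rfl | hd'
    · cases l with
      | nil => exact Or.inl h.2.2
      | cons d₂ l => right; have := h.2.2.2.1; simp [this]
    · rcases ih h.2.2 d' hd' with h' | h'
      · exact Or.inl h'
      · right; exact List.mem_cons_of_mem _ h'

/-- Every walk contains a path, that is, a walk without repeated vertices or edges. -/
theorem IsWalk.exists_path {l : List (E × Bool)} {u v : V} (h : G.IsWalk u l v) :
    ∃ l', G.IsWalk u l' v ∧ (∀ d ∈ l', d ∈ l) ∧ (l'.map G.dartStart).Nodup ∧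
      v ∉ l'.map G.dartStart ∧ (l'.map Prod.fst).Nodup := by
  induction l generalizing u with
  | nil => exact ⟨[], h, by simp⟩
  | cons d l ih =>
    obtain ⟨l', hw, hsub, hnd, hv, hnd'⟩ := ih h.2.2
    by_cases huv : u = v
    · exact ⟨[], huv, by simp⟩
    by_cases hu : u ∈ l'.map G.dartStart
    · obtain ⟨d', hd', hu'⟩ := List.mem_map.1 hu
      obtain ⟨l₁, l₂, rfl⟩ := List.append_of_mem hd'
      obtain ⟨w, -, hw₂⟩ := hw.of_append
      refine ⟨d' :: l₂, ⟨hw₂.1, hu', hw₂.2.2⟩, ?_, ?_, ?_, ?_⟩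
      · intro x hx
        exact List.mem_cons_of_mem _ (hsub x (List.mem_append_right _ hx))
      · rw [List.map_append] at hnd
        exact (List.nodup_append.1 hnd).2.1
      · intro hx
        apply hv
        rw [List.map_append]
        exact List.mem_append_right _ hx
      · rw [List.map_append] at hnd'
        exact (List.nodup_append.1 hnd').2.1
    · refine ⟨d :: l', ⟨h.1, h.2.1, hw⟩, ?_, ?_, ?_, ?_⟩
      · intro x hx
        rcases List.mem_cons.1 hx with rfl | hx
        · exact List.mem_cons_self
        · exact List.mem_cons_of_mem _ (hsub x hx)
      · rw [List.map_cons, List.nodup_cons, h.2.1]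
        exact ⟨hu, hnd⟩
      · rw [List.map_cons, List.mem_cons, h.2.1]
        rintro (h' | h')
        · exact huv h'.symm
        · exact hv h'
      · rw [List.map_cons, List.nodup_cons]
        -- If the first edge recurs in the path, its tail `u` is an end of a path edge, so `u` is
        -- either `v` or a vertex already visited; both are excluded.
        refine ⟨fun hmem => ?_, hnd'⟩
        obtain ⟨d', hd', hdd⟩ := List.mem_map.1 hmem
        have hs : G.dartStart d' ∈ l'.map G.dartStart := List.mem_map_of_mem hd'
        have he := hw.dartEnd_mem d' hd'
        have : u = G.dartStart d' ∨ u = G.dartEnd d' := by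
          rw [← h.2.1]
          unfold dartStart dartEnd
          rw [hdd]
          cases d.2 <;> cases d'.2 <;> simp
        rcases this with rfl | rfl
        · exact hu hs
        · rcases he with he | he
          · exact huv he
          · exact hu he

theorem IsWalk.mono {l : List (E × Bool)} {u v : V} (hs : G.src = H.src) (ht : G.tgt = H.tgt)
    (hE : ∀ d ∈ l, d.1 ∈ G.edges → d.1 ∈ H.edges) (h : G.IsWalk u l v) : H.IsWalk u l v := by
  induction l generalizing u with
  | nil => exact h
  | cons d l ih =>
    refine ⟨hE d List.mem_cons_self h.1, ?_, ?_⟩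
    · rw [← h.2.1]; simp [dartStart, hs, ht]
    · have := ih (fun d' hd' => hE d' (List.mem_cons_of_mem _ hd')) h.2.2
      simpa [dartEnd, hs, ht] using this

theorem IsWalk.of_restrict [DecidableEq E] {A : Finset E} {l : List (E × Bool)} {u v : V}
    (h : (G.restrict A).IsWalk u l v) : G.IsWalk u l v :=
  IsWalk.mono (G := G.restrict A) rfl rfl (fun _ _ he => (Finset.mem_inter.1 he).1) h

/-- Closing a path by an edge outside it yields a signed cycle. -/
theorem exists_signedCycle_of_path [DecidableEq E] {l : List (E × Bool)} {d : E × Bool}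
    (hd : d.1 ∈ G.edges) (hw : G.IsWalk (G.dartEnd d) l (G.dartStart d))
    (hnd : (l.map G.dartStart).Nodup) (hv : G.dartStart d ∉ l.map G.dartStart)
    (hnd' : (l.map Prod.fst).Nodup) (hdl : d.1 ∉ l.map Prod.fst) :
    ∃ C : SignedEdgeSet E, G.IsSignedCycle C ∧
      ∀ e, (e ∈ C.pos ↔ (e, true) ∈ d :: l) ∧ (e ∈ C.neg ↔ (e, false) ∈ d :: l) := by
  classical
  have hN : ((d :: l).map Prod.fst).Nodup := by
    rw [List.map_cons, List.nodup_cons]; exact ⟨hdl, hnd'⟩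
  let P : Bool → Finset E := fun b => (((d :: l).filter fun x => x.2 = b).map Prod.fst).toFinset
  have hP : ∀ b e, e ∈ P b ↔ (e, b) ∈ d :: l := by
    intro b e
    simp only [P, List.mem_toFinset, List.mem_map, List.mem_filter, decide_eq_true_eq]
    constructor
    · rintro ⟨⟨x, c⟩, ⟨h1, h2⟩, h3⟩
      simp only at h2 h3
      subst h2; subst h3; exact h1
    · intro h; exact ⟨(e, b), ⟨h, rfl⟩, rfl⟩
  refine ⟨⟨P true, P false, ?_⟩, ⟨G.dartStart d, d :: l, by simp, ⟨hd, rfl, hw⟩, ?_, hN, ?_⟩, ?_⟩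
  · rw [Finset.disjoint_left]
    intro e h1 h2
    rw [hP] at h1 h2
    have := List.inj_on_of_nodup_map hN h1 h2 rfl
    simp at this
  · rw [List.map_cons, List.nodup_cons]; exact ⟨hv, hnd⟩
  · exact fun e => ⟨hP _ _, hP _ _⟩
  · exact fun e => ⟨hP _ _, hP _ _⟩

end Walks

/-! ### Tensions and their orthogonality to cycles -/

/-- Tensions: differences of a potential along the edges. -/
def IsTension {V E : Type*} (G : MultiDigraph V E) (x : E → ℝ) : Prop :=
  ∃ φ : V → ℝ, ∀ e, x e = φ (G.src e) - φ (G.tgt e)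

open Classical in
/-- The tension of the indicator function of a set of vertices. -/
noncomputable def cutTension {V E : Type*} (G : MultiDigraph V E) (S : Set V) (e : E) : ℝ :=
  (if G.src e ∈ S then 1 else 0) - (if G.tgt e ∈ S then 1 else 0)

section Tensions

variable {V E : Type*} {G : MultiDigraph V E}

theorem isTension_cutTension (S : Set V) : G.IsTension (G.cutTension S) := by
  classical
  exact ⟨fun v => if v ∈ S then 1 else 0, fun e => by unfold cutTension; congr⟩

theorem IsTension.add {x y : E → ℝ} (hx : G.IsTension x) (hy : G.IsTension y) :
    G.IsTension (fun e => x e + y e) := by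
  obtain ⟨φ, hφ⟩ := hx
  obtain ⟨ψ, hψ⟩ := hy
  exact ⟨fun v => φ v + ψ v, fun e => by simp only [hφ, hψ]; ring⟩

theorem IsTension.const_mul {x : E → ℝ} (hx : G.IsTension x) (c : ℝ) :
    G.IsTension (fun e => c * x e) := by
  obtain ⟨φ, hφ⟩ := hx
  exact ⟨fun v => c * φ v, fun e => by simp only [hφ]; ring⟩

theorem IsTension.sub {x y : E → ℝ} (hx : G.IsTension x) (hy : G.IsTension y) :
    G.IsTension (fun e => x e - y e) := by
  obtain ⟨φ, hφ⟩ := hx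
  obtain ⟨ψ, hψ⟩ := hy
  exact ⟨fun v => φ v - ψ v, fun e => by simp only [hφ, hψ]; ring⟩

theorem isTension_sum {ι : Type*} (s : Finset ι) {f : ι → E → ℝ}
    (hf : ∀ i ∈ s, G.IsTension (f i)) : G.IsTension (fun e => ∑ i ∈ s, f i e) := by
  classical
  induction s using Finset.induction_on with
  | empty => exact ⟨fun _ => 0, by simp⟩
  | insert a s ha ih =>
    simp only [Finset.sum_insert ha]
    exact (hf a (Finset.mem_insert_self _ _)).add
      (ih fun i hi => hf i (Finset.mem_insert_of_mem hi))

theorem cutTension_eq_one_iff {S : Set V} {e : E} :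
    G.cutTension S e = 1 ↔ G.src e ∈ S ∧ G.tgt e ∉ S := by
  unfold cutTension
  split_ifs <;> norm_num <;> simp_all

theorem cutTension_eq_neg_one_iff {S : Set V} {e : E} :
    G.cutTension S e = -1 ↔ G.src e ∉ S ∧ G.tgt e ∈ S := by
  unfold cutTension
  split_ifs <;> norm_num <;> simp_all

theorem cutTension_eq_zero_iff {S : Set V} {e : E} :
    G.cutTension S e = 0 ↔ (G.src e ∈ S ↔ G.tgt e ∈ S) := by
  unfold cutTension
  split_ifs <;> simp_all

theorem cutTension_trichotomy (S : Set V) (e : E) :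
    G.cutTension S e = 1 ∨ G.cutTension S e = -1 ∨ G.cutTension S e = 0 := by
  unfold cutTension
  split_ifs <;> simp

theorem mem_cutOut {S : Set V} {e : E} :
    e ∈ G.cutOut S ↔ e ∈ G.edges ∧ G.cutTension S e = 1 := by
  simp [cutOut, cutTension_eq_one_iff]

theorem mem_cutIn {S : Set V} {e : E} :
    e ∈ G.cutIn S ↔ e ∈ G.edges ∧ G.cutTension S e = -1 := by
  simp [cutIn, cutTension_eq_neg_one_iff]

theorem mem_cut [DecidableEq E] {S : Set V} {e : E} :
    e ∈ G.cutOut S ∪ G.cutIn S ↔ e ∈ G.edges ∧ G.cutTension S e ≠ 0 := by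
  rw [Finset.mem_union, mem_cutOut, mem_cutIn]
  rcases cutTension_trichotomy (G := G) S e with h | h | h <;> simp [h] <;> norm_num

/-- The definition of a tension ignores which edges are present, so deletion leaves the tension
space untouched; only contraction shrinks it. -/
theorem isTension_restrict [DecidableEq E] {A : Finset E} {x : E → ℝ} :
    (G.restrict A).IsTension x ↔ G.IsTension x := Iff.rfl

theorem cutTension_restrict [DecidableEq E] {A : Finset E} (S : Set V) :
    (G.restrict A).cutTension S = G.cutTension S := rfl

/-- A potential descends to the quotient exactly when it agrees at the two ends of `p`; it can then
be kept as it is, because `glue` does not change its values. -/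
theorem isTension_contract [DecidableEq E] {p : E} {x : E → ℝ} :
    (G.contract p).IsTension x ↔ G.IsTension x ∧ x p = 0 := by
  constructor
  · rintro ⟨φ, hφ⟩
    refine ⟨⟨fun v => φ (G.glue p v), hφ⟩, ?_⟩
    rw [hφ p]
    simp only [contract, glue]
    split_ifs <;> simp
  · rintro ⟨⟨φ, hφ⟩, h⟩
    refine ⟨φ, fun e => ?_⟩
    have hg : ∀ v, φ (G.glue p v) = φ v := by
      intro v
      unfold glue
      split_ifs with hv
      · rw [hv]; rw [hφ] at h; linarith
      · rfl
    change x e = φ (G.glue p (G.src e)) - φ (G.glue p (G.tgt e))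
    rw [hg, hg, hφ]

theorem IsWalk.sum_eq {φ : V → ℝ} {l : List (E × Bool)} {u v : V} (h : G.IsWalk u l v) :
    (l.map fun d => (if d.2 then (1 : ℝ) else -1) * (φ (G.src d.1) - φ (G.tgt d.1))).sum =
      φ u - φ v := by
  induction l generalizing u with
  | nil => cases h; simp
  | cons d l ih =>
    rw [List.map_cons, List.sum_cons, ih h.2.2, ← h.2.1]
    unfold dartStart dartEnd
    cases d.2 <;> simp

theorem IsSignedCycle.supp_subset [DecidableEq E] {C : SignedEdgeSet E} (hC : G.IsSignedCycle C) :
    C.supp ⊆ G.edges := by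
  obtain ⟨u, l, -, hw, -, -, hl⟩ := hC
  intro e he
  rcases Finset.mem_union.1 he with h | h
  · exact hw.mem_edges _ ((hl e).1.1 h)
  · exact hw.mem_edges _ ((hl e).2.1 h)

theorem IsSignedCycle.supp_nonempty [DecidableEq E] {C : SignedEdgeSet E}
    (hC : G.IsSignedCycle C) : C.supp.Nonempty := by
  obtain ⟨u, l, hl0, hw, -, -, hl⟩ := hC
  obtain ⟨⟨e, b⟩, l', rfl⟩ := List.exists_cons_of_ne_nil hl0
  refine ⟨e, Finset.mem_union.2 ?_⟩
  cases b
  · right; rw [(hl e).2]; simp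
  · left; rw [(hl e).1]; simp

/-- Cycles are orthogonal to tensions. -/
theorem IsSignedCycle.sum_eq_zero [DecidableEq E] {C : SignedEdgeSet E} (hC : G.IsSignedCycle C)
    {x : E → ℝ} (hx : G.IsTension x) : ∑ e ∈ C.supp, (C.sign e : ℝ) * x e = 0 := by
  obtain ⟨u, l, -, hw, -, hnd, hl⟩ := hC
  obtain ⟨φ, hφ⟩ := hx
  have hs : C.supp = (l.map Prod.fst).toFinset := by
    ext e
    simp only [SignedEdgeSet.supp, Finset.mem_union, (hl e).1, (hl e).2, List.mem_toFinset,
      List.mem_map]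
    constructor
    · rintro (h | h) <;> exact ⟨_, h, rfl⟩
    · rintro ⟨⟨e', b⟩, h, rfl⟩
      cases b
      · exact Or.inr h
      · exact Or.inl h
  rw [hs, List.sum_toFinset _ hnd, List.map_map]
  have := hw.sum_eq (φ := φ)
  rw [sub_self] at this
  rw [← this]
  congr 1
  apply List.map_congr_left
  rintro ⟨e, b⟩ hd
  simp only [Function.comp, hφ]
  cases b
  · rw [SignedEdgeSet.sign_of_mem_neg ((hl e).2.2 hd)]; simp
  · rw [SignedEdgeSet.sign_of_mem_pos ((hl e).1.2 hd)]; simp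

/-- Replaces walks by linear algebra. For the converse, the test potential is the indicator of the
set of vertices reachable from `u`. -/
theorem connected_iff : G.Connected ↔ G.verts.Nonempty ∧ ∀ φ : V → ℝ,
    (∀ e ∈ G.edges, φ (G.src e) = φ (G.tgt e)) → ∀ u ∈ G.verts, ∀ v ∈ G.verts, φ u = φ v := by
  classical
  refine and_congr_right fun _ => ⟨fun h φ hφ u hu v hv => ?_, fun h u hu v hv => ?_⟩
  · obtain ⟨l, hl⟩ := h u hu v hv
    have h0 := hl.sum_eq (φ := φ)
    rw [List.sum_eq_zero] at h0
    · linarith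
    · intro y hy
      obtain ⟨d, hd, rfl⟩ := List.mem_map.1 hy
      rw [hφ _ (hl.mem_edges d hd)]
      simp
  · have key := h (fun w => if ∃ l, G.IsWalk u l w then 1 else 0) ?_ u hu v hv
    · have hu' : ∃ l, G.IsWalk u l u := ⟨[], rfl⟩
      by_contra hv'
      simp only [if_pos hu', if_neg hv'] at key
      norm_num at key
    · intro e he
      have : (∃ l, G.IsWalk u l (G.src e)) ↔ ∃ l, G.IsWalk u l (G.tgt e) := by
        constructor
        · rintro ⟨l, hl⟩
          exact ⟨l ++ [(e, true)], hl.append ⟨he, rfl, rfl⟩⟩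
        · rintro ⟨l, hl⟩
          exact ⟨l ++ [(e, false)], hl.append ⟨he, rfl, rfl⟩⟩
      simp only [this]

theorem Connected.contract [DecidableEq E] (hG : G.Connected) (p : E) :
    (G.contract p).Connected := by
  classical
  rw [connected_iff] at hG ⊢
  refine ⟨hG.1.image _, fun φ hφ => ?_⟩
  have key := hG.2 (fun v => φ (G.glue p v)) ?_
  · intro u hu v hv
    obtain ⟨u', hu', rfl⟩ := Finset.mem_image.1 hu
    obtain ⟨v', hv', rfl⟩ := Finset.mem_image.1 hv
    exact key u' hu' v' hv'
  · intro e he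
    by_cases hep : e = p
    · subst hep
      simp only [glue]
      split_ifs <;> simp
    · exact hφ e (Finset.mem_erase.2 ⟨hep, he⟩)

end Tensions

/-! ### Spanning trees, fundamental cycles and cocycles through tensions -/

section Trees

variable {V E : Type*} [DecidableEq E] {G : MultiDigraph V E} {T : Finset E}

theorem Connected.restrict (hG : G.Connected) (hT : T ⊆ G.edges)
    (h : ∀ x, G.IsTension x → (∀ b ∈ T, x b = 0) → ∀ e ∈ G.edges, x e = 0) :
    (G.restrict T).Connected := by
  rw [connected_iff] at hG ⊢
  refine ⟨hG.1, fun φ hφ => hG.2 φ fun e he => ?_⟩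
  have := h (fun e => φ (G.src e) - φ (G.tgt e)) ⟨φ, fun _ => rfl⟩ (fun b hb => by
    rw [sub_eq_zero]
    exact hφ b (Finset.mem_inter.2 ⟨hT hb, hb⟩)) e he
  exact sub_eq_zero.1 this

theorem IsSpanningTree.eq_zero (hT : G.IsSpanningTree T) {x : E → ℝ} (hx : G.IsTension x)
    (h : ∀ b ∈ T, x b = 0) : ∀ e ∈ G.edges, x e = 0 := by
  obtain ⟨φ, hφ⟩ := hx
  intro e he
  rw [hφ, (connected_iff.1 hT.2.1).2 φ (fun b hb => ?_) _ (G.src_mem e he) _ (G.tgt_mem e he),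
    sub_self]
  have := h b (Finset.mem_inter.1 hb).2
  rw [hφ] at this
  exact sub_eq_zero.1 this

theorem IsSpanningTree.connected (hT : G.IsSpanningTree T) : G.Connected := by
  refine ⟨hT.2.1.1, fun u hu v hv => ?_⟩
  obtain ⟨l, hl⟩ := hT.2.1.2 u hu v hv
  exact ⟨l, hl.of_restrict⟩

theorem isSpanningTree_of (hG : G.Connected) (hT : T ⊆ G.edges)
    (h : ∀ x, G.IsTension x → (∀ b ∈ T, x b = 0) → ∀ e ∈ G.edges, x e = 0)
    (h' : ∀ C, G.IsSignedCycle C → ¬ C.supp ⊆ T) : G.IsSpanningTree T :=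
  ⟨hT, hG.restrict hT h, fun ⟨C, hC, hCT⟩ => h' C hC hCT⟩

/-- Each edge of a spanning tree is the only tree edge of some cut. -/
theorem IsSpanningTree.exists_cut (hT : G.IsSpanningTree T) {b : E} (hb : b ∈ T) :
    ∃ S : Set V, G.cutTension S b = 1 ∧ ∀ b' ∈ T, b' ≠ b → G.cutTension S b' = 0 := by
  let H := G.restrict (T.erase b)
  -- The side of the cut is the component of the tail of `b` in the tree without `b`; if it
  -- contained the head, a path would close with `b` into a cycle of the tree.
  let S : Set V := {v | ∃ l, H.IsWalk (G.src b) l v}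
  refine ⟨S, cutTension_eq_one_iff.2 ⟨⟨[], rfl⟩, ?_⟩, fun b' hb' hne => ?_⟩
  · rintro ⟨l, hl⟩
    obtain ⟨l', hw, -, hnd, hv, hnd'⟩ := hl.exists_path
    have hsub : ∀ d ∈ l', d.1 ∈ T.erase b := fun d hd => (Finset.mem_inter.1 (hw.mem_edges d hd)).2
    obtain ⟨C, hC, hCl⟩ := exists_signedCycle_of_path (G := G) (d := (b, false)) (l := l')
      (hT.1 hb) hw.of_restrict hnd hv hnd' (fun h => by
        obtain ⟨d, hd, hdb⟩ := List.mem_map.1 h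
        exact (Finset.mem_erase.1 (hsub d hd)).1 hdb)
    refine hT.2.2 ⟨C, hC, fun e he => ?_⟩
    rcases Finset.mem_union.1 he with h | h
    · rcases List.mem_cons.1 ((hCl e).1.1 h) with h | h
      · simp at h
      · exact Finset.mem_of_mem_erase (hsub _ h)
    · rcases List.mem_cons.1 ((hCl e).2.1 h) with h | h
      · rw [Prod.mk.injEq] at h; rw [h.1]; exact hb
      · exact Finset.mem_of_mem_erase (hsub _ h)
  · rw [cutTension_eq_zero_iff]
    have hH : b' ∈ H.edges := Finset.mem_inter.2 ⟨hT.1 hb', Finset.mem_erase.2 ⟨hne, hb'⟩⟩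
    constructor
    · rintro ⟨l, hl⟩
      exact ⟨l ++ [(b', true)], hl.append ⟨hH, rfl, rfl⟩⟩
    · rintro ⟨l, hl⟩
      exact ⟨l ++ [(b', false)], hl.append ⟨hH, rfl, rfl⟩⟩

theorem IsSpanningTree.exists_fundCycle (hT : G.IsSpanningTree T) {e : E} (he : e ∈ G.edges)
    (heT : e ∉ T) : ∃ C, G.IsFundCycle T e C := by
  obtain ⟨l, hl⟩ := hT.2.1.2 _ (G.tgt_mem e he) _ (G.src_mem e he)
  obtain ⟨l', hw, -, hnd, hv, hnd'⟩ := hl.exists_path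
  have hsub : ∀ d ∈ l', d.1 ∈ T := fun d hd => (Finset.mem_inter.1 (hw.mem_edges d hd)).2
  obtain ⟨C, hC, hCl⟩ := exists_signedCycle_of_path (G := G) (d := (e, true)) (l := l')
    he hw.of_restrict hnd hv hnd' (fun h => by
      obtain ⟨d, hd, hde⟩ := List.mem_map.1 h
      have := hsub d hd
      simp only at hde
      rw [hde] at this
      exact heT this)
  refine ⟨C, hC, (hCl e).1.2 List.mem_cons_self, fun f hf => ?_⟩
  rcases Finset.mem_union.1 hf with h | h
  · rcases List.mem_cons.1 ((hCl f).1.1 h) with h | h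
    · rw [Prod.mk.injEq] at h; rw [h.1]; exact Finset.mem_insert_self _ _
    · exact Finset.mem_insert_of_mem (hsub _ h)
  · rcases List.mem_cons.1 ((hCl f).2.1 h) with h | h
    · simp at h
    · exact Finset.mem_insert_of_mem (hsub _ h)

/-- A cut that meets a spanning edge set in a single edge is a cocycle. -/
theorem isCocycle_of_cutTension (hT : T ⊆ G.edges)
    (h : ∀ x, G.IsTension x → (∀ b ∈ T, x b = 0) → ∀ e ∈ G.edges, x e = 0) {b : E} (hb : b ∈ T)
    {S : Set V} (h1 : G.cutTension S b ≠ 0) (h0 : ∀ b' ∈ T, b' ≠ b → G.cutTension S b' = 0) :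
    G.IsCocycle (G.cutOut S ∪ G.cutIn S) := by
  refine ⟨⟨⟨b, mem_cut.2 ⟨hT hb, h1⟩⟩, S, rfl⟩, ?_⟩
  rintro D ⟨⟨d, hd⟩, S', rfl⟩ hle e he
  have hz : ∀ b' ∈ T, b' ≠ b → G.cutTension S' b' = 0 := by
    intro b' hb' hne
    by_contra hne0
    exact (mem_cut.1 (hle (mem_cut.2 ⟨hT hb', hne0⟩))).2 (h0 b' hb' hne)
  -- This combination cancels at `b` and hence on all of `T`, so the two cut tensions are
  -- proportional on the edges; both factors turn out to be nonzero, so the supports agree.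
  have key := h (fun e => G.cutTension S b * G.cutTension S' e -
    G.cutTension S' b * G.cutTension S e)
    (((isTension_cutTension S').const_mul _).sub ((isTension_cutTension S).const_mul _)) (by
      intro b' hb'
      by_cases hbb : b' = b
      · subst hbb; ring
      · rw [hz b' hb' hbb, h0 b' hb' hbb]; ring)
  have hS' : G.cutTension S' b ≠ 0 := by
    intro hb0
    have := key d (mem_cut.1 hd).1
    rw [hb0, zero_mul, sub_zero] at this
    exact (mul_ne_zero h1 (mem_cut.1 hd).2) this
  rw [mem_cut] at he ⊢
  refine ⟨he.1, fun h0' => ?_⟩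
  have := key e he.1
  rw [h0', mul_zero, zero_sub, neg_eq_zero] at this
  exact (mul_ne_zero hS' he.2) this

/-- The signed edge set of a cut. -/
noncomputable def signedCut (G : MultiDigraph V E) (S : Set V) : SignedEdgeSet E where
  pos := G.cutOut S
  neg := G.cutIn S
  disj := by
    rw [Finset.disjoint_left]
    intro e h1 h2
    have := (mem_cutOut.1 h1).2.symm.trans (mem_cutIn.1 h2).2
    norm_num at this

theorem sign_eq_cutTension {C : SignedEdgeSet E} {S : Set V} (h1 : C.pos = G.cutOut S)
    (h2 : C.neg = G.cutIn S) {e : E} (he : e ∈ G.edges) : (C.sign e : ℝ) = G.cutTension S e := by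
  rcases cutTension_trichotomy (G := G) S e with h | h | h
  · rw [SignedEdgeSet.sign_of_mem_pos (by rw [h1, mem_cutOut]; exact ⟨he, h⟩), h]; simp
  · rw [SignedEdgeSet.sign_of_mem_neg (by rw [h2, mem_cutIn]; exact ⟨he, h⟩), h]; simp
  · rw [SignedEdgeSet.sign_eq_zero_iff.2, h]
    · simp
    · unfold SignedEdgeSet.supp
      rw [h1, h2, mem_cut]
      simp [h]

theorem supp_subset_of_cut {C : SignedEdgeSet E} {S : Set V} (h1 : C.pos = G.cutOut S)
    (h2 : C.neg = G.cutIn S) : C.supp ⊆ G.edges := by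
  intro e he
  unfold SignedEdgeSet.supp at he
  rw [h1, h2, mem_cut] at he
  exact he.1

theorem IsSignedCocycle.supp_subset {C : SignedEdgeSet E} (hC : G.IsSignedCocycle C) :
    C.supp ⊆ G.edges := by
  obtain ⟨-, S, h1, h2⟩ := hC
  exact supp_subset_of_cut h1 h2

theorem sign_cast_eq_one_iff {C : SignedEdgeSet E} {e : E} : (C.sign e : ℝ) = 1 ↔ e ∈ C.pos := by
  rw [← SignedEdgeSet.sign_eq_one_iff]; norm_cast

theorem sign_cast_eq_neg_one_iff {C : SignedEdgeSet E} {e : E} :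
    (C.sign e : ℝ) = -1 ↔ e ∈ C.neg := by
  rw [← SignedEdgeSet.sign_eq_neg_one_iff]; norm_cast

theorem sign_cast_eq_zero_iff {C : SignedEdgeSet E} {e : E} :
    (C.sign e : ℝ) = 0 ↔ e ∉ C.supp := by
  rw [← SignedEdgeSet.sign_eq_zero_iff]; norm_cast

/-- A signed fundamental cocycle is determined by the dual tension of its tree edge. -/
theorem IsFundCocycle.sign_eq (hT : G.IsSpanningTree T) {b : E} (hb : b ∈ T)
    {C : SignedEdgeSet E} (hC : G.IsFundCocycle T b C) {x : E → ℝ} (hx : G.IsTension x)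
    (hxb : x b = 1) (hx0 : ∀ b' ∈ T, b' ≠ b → x b' = 0) {e : E} (he : e ∈ G.edges) :
    (C.sign e : ℝ) = x e := by
  obtain ⟨⟨-, S, h1, h2⟩, hbC, hsub⟩ := hC
  rw [sign_eq_cutTension h1 h2 he, ← sub_eq_zero]
  refine hT.eq_zero ((isTension_cutTension S).sub hx) (fun b' hb' => ?_) e he
  rw [← sign_eq_cutTension h1 h2 (hT.1 hb')]
  by_cases hbb : b' = b
  · subst hbb
    rw [sign_cast_eq_one_iff.2 hbC, hxb, sub_self]
  · rw [hx0 b' hb' hbb, sign_cast_eq_zero_iff.2, sub_self]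
    intro hmem
    rcases Finset.mem_insert.1 (hsub hmem) with h | h
    · exact hbb h
    · exact (Finset.mem_sdiff.1 h).2 hb'

theorem isSignedCocycle_signedCut (hT : T ⊆ G.edges)
    (h : ∀ x, G.IsTension x → (∀ b ∈ T, x b = 0) → ∀ e ∈ G.edges, x e = 0) {b : E} (hb : b ∈ T)
    {S : Set V} (h1 : G.cutTension S b ≠ 0) (h0 : ∀ b' ∈ T, b' ≠ b → G.cutTension S b' = 0) :
    G.IsSignedCocycle (G.signedCut S) :=
  ⟨isCocycle_of_cutTension hT h hb h1 h0, S, rfl, rfl⟩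

theorem IsSpanningTree.isFundCocycle_signedCut (hT : G.IsSpanningTree T) {b : E} (hb : b ∈ T)
    {S : Set V} (h1 : G.cutTension S b = 1) (h0 : ∀ b' ∈ T, b' ≠ b → G.cutTension S b' = 0) :
    G.IsFundCocycle T b (G.signedCut S) := by
  refine ⟨isSignedCocycle_signedCut hT.1 (fun _ => hT.eq_zero) hb (by rw [h1]; norm_num) h0,
    mem_cutOut.2 ⟨hT.1 hb, h1⟩, fun e he => ?_⟩
  have he' := mem_cut.1 he
  rw [Finset.mem_insert, Finset.mem_sdiff]
  by_cases heb : e = b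
  · exact Or.inl heb
  · exact Or.inr ⟨he'.1, fun heT => he'.2 (h0 e heT heb)⟩

/-- The coefficient of a tree edge in a fundamental cycle is opposite to that of the non-tree edge
in the fundamental cocycle. -/
theorem IsFundCycle.sign_eq {e : E} (heT : e ∉ T) {C : SignedEdgeSet E} (hC : G.IsFundCycle T e C)
    {b : E} (hb : b ∈ T) {x : E → ℝ} (hx : G.IsTension x)
    (hxb : x b = 1) (hx0 : ∀ b' ∈ T, b' ≠ b → x b' = 0) : (C.sign b : ℝ) = - x e := by
  obtain ⟨hC, heC, hsub⟩ := hC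
  have h := hC.sum_eq_zero hx
  rw [Finset.sum_subset hsub (fun f _ hf => by rw [sign_cast_eq_zero_iff.2 hf, zero_mul]),
    Finset.sum_insert heT, sign_cast_eq_one_iff.2 heC, Finset.sum_eq_single b, hxb] at h
  · linarith
  · intro f hf hfb
    rw [hx0 f hf hfb, mul_zero]
  · exact fun h' => absurd hb h'

/-- A dimension count: a potential is determined by its differences along the tree edges and its
value at one base vertex, and these can be prescribed freely. -/
theorem IsSpanningTree.card_eq (hT : G.IsSpanningTree T) : T.card + 1 = G.verts.card := by
  obtain ⟨v₀, hv₀⟩ := hT.2.1.1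
  let s : T → G.verts := fun b => ⟨G.src b, G.src_mem _ (hT.1 b.2)⟩
  let t : T → G.verts := fun b => ⟨G.tgt b, G.tgt_mem _ (hT.1 b.2)⟩
  let Ψ : (G.verts → ℝ) →ₗ[ℝ] (T → ℝ) × ℝ :=
    { toFun := fun φ => (fun b => φ (s b) - φ (t b), φ ⟨v₀, hv₀⟩)
      map_add' := fun φ ψ => by ext <;> simp; ring
      map_smul' := fun c φ => by ext <;> simp; ring }
  have hinj : Function.Injective Ψ := by
    rw [injective_iff_map_eq_zero]
    intro φ hφ
    have h1 : ∀ b, φ (s b) - φ (t b) = 0 := fun b => congr_fun (congr_arg Prod.fst hφ) b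
    have h2 : φ ⟨v₀, hv₀⟩ = 0 := congr_arg Prod.snd hφ
    classical
    have key := (connected_iff.1 hT.2.1).2 (fun v => if hv : v ∈ G.verts then φ ⟨v, hv⟩ else 0)
      (fun e he => by
        have he' := Finset.mem_inter.1 he
        have h := h1 ⟨e, he'.2⟩
        change (if hv : G.src e ∈ G.verts then _ else _) =
          (if hv : G.tgt e ∈ G.verts then _ else _)
        rw [dif_pos (G.src_mem e he'.1), dif_pos (G.tgt_mem e he'.1)]
        exact sub_eq_zero.1 h)
    ext ⟨v, hv⟩
    have := key v hv v₀ hv₀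
    rw [dif_pos hv, dif_pos (show v₀ ∈ G.verts from hv₀)] at this
    rw [this, h2]; rfl
  have hsurj : Function.Surjective Ψ := by
    rintro ⟨y, c⟩
    choose S hS1 hS0 using fun b : T => hT.exists_cut b.2
    obtain ⟨φ, hφ⟩ := isTension_sum (G := G) Finset.univ
      (f := fun (b : T) e => y b * G.cutTension (S b) e)
      (fun b _ => (isTension_cutTension (S b)).const_mul (y b))
    refine ⟨fun v => φ v - φ v₀ + c, ?_⟩
    ext b
    · change (φ (G.src b) - φ v₀ + c) - (φ (G.tgt b) - φ v₀ + c) = y b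
      have h : ∑ i, y i * G.cutTension (S i) b = φ (G.src b) - φ (G.tgt b) := hφ b
      rw [Finset.sum_eq_single b] at h
      · rw [hS1] at h; linarith
      · intro b' _ hne
        rw [hS0 b' b b.2 (fun h => hne (Subtype.ext h.symm)), mul_zero]
      · simp
    · change φ v₀ - φ v₀ + c = c
      ring
  have := (LinearEquiv.ofBijective Ψ ⟨hinj, hsurj⟩).finrank_eq
  simpa using this.symm

/-- Along a directed cycle all signs are 1, so a tension that is nonnegative on it and positive
somewhere contradicts orthogonality. The tension may depend on the candidate cycle. -/
theorem acyclic_of_tension {A : Finset E}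
    (h : ∀ C : SignedEdgeSet E, C.supp.Nonempty → C.supp ⊆ A → ∃ x, G.IsTension x ∧
      (∀ e ∈ C.supp, 0 ≤ x e) ∧ ∃ e ∈ C.supp, 0 < x e) : (G.restrict A).Acyclic := by
  rintro ⟨C, hC, hneg⟩
  obtain ⟨x, hx, h0, e, he, hpos⟩ := h C hC.supp_nonempty
    (fun e he => (Finset.mem_inter.1 (hC.supp_subset he)).2)
  have hs := hC.sum_eq_zero hx
  have hsign : ∀ f ∈ C.supp, (C.sign f : ℝ) = 1 := by
    intro f hf
    rw [sign_cast_eq_one_iff]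
    simpa [SignedEdgeSet.supp, hneg] using hf
  rw [Finset.sum_congr rfl (fun f hf => by rw [hsign f hf, one_mul])] at hs
  exact absurd hs (Finset.sum_pos' h0 ⟨e, he, hpos⟩).ne'

/-- An acyclic digraph has a strictly decreasing potential. -/
theorem Acyclic.exists_tension (hG : G.Acyclic) :
    ∃ x, G.IsTension x ∧ ∀ e ∈ G.edges, 0 < x e := by
  classical
  -- The potential of `v` is the number of vertices reachable from it by directed walks. It drops
  -- along each edge, since by acyclicity the tail cannot be reached from the head.
  let R : V → Finset V := fun v =>
    G.verts.filter fun w => ∃ l, G.IsWalk v l w ∧ ∀ d ∈ l, d.2 = true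
  refine ⟨fun e => ((R (G.src e)).card : ℝ) - ((R (G.tgt e)).card : ℝ),
    ⟨fun v => (R v).card, fun _ => rfl⟩, fun e he => ?_⟩
  rw [sub_pos, Nat.cast_lt]
  apply Finset.card_lt_card
  rw [Finset.ssubset_iff_of_subset]
  · refine ⟨G.src e, Finset.mem_filter.2 ⟨G.src_mem e he, [], rfl, by simp⟩, fun hmem => ?_⟩
    obtain ⟨-, l, hl, hdir⟩ := Finset.mem_filter.1 hmem
    obtain ⟨l', hw, hsub, hnd, hv, hnd'⟩ := hl.exists_path
    obtain ⟨C, hC, hCl⟩ := exists_signedCycle_of_path (G := G) (d := (e, true)) (l := l')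
      he hw hnd hv hnd' (fun h => by
        obtain ⟨⟨f, b⟩, hd, hde⟩ := List.mem_map.1 h
        have hb := hdir _ (hsub _ hd)
        simp only at hde hb
        subst hde; subst hb
        exact hv (List.mem_map_of_mem (f := G.dartStart) hd))
    refine hG ⟨C, hC, Finset.eq_empty_of_forall_notMem fun f hf => ?_⟩
    rcases List.mem_cons.1 ((hCl f).2.1 hf) with h | h
    · simp at h
    · have := hdir _ (hsub _ h)
      simp at this
  · intro w hw
    obtain ⟨hwv, l, hl, hdir⟩ := Finset.mem_filter.1 hw
    refine Finset.mem_filter.2 ⟨hwv, (e, true) :: l, ⟨he, rfl, hl⟩, fun d hd => ?_⟩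
    rcases List.mem_cons.1 hd with rfl | hd
    · rfl
    · exact hdir d hd

end Trees

end MultiDigraph

namespace MultiDigraph

/-! ### Weights that imitate lexicographic comparison -/

section LexWeights

variable {E : Type*} [LinearOrder E]

/-- Positive weights for which each element outweighs all larger ones together. -/
def IsLexWeight (s : Finset E) (w : E → ℝ) : Prop :=
  (∀ e ∈ s, 0 < w e) ∧ ∀ a ∈ s, ∑ e ∈ s.filter (a < ·), w e < w a

theorem exists_isLexWeight (s : Finset E) : ∃ w : E → ℝ, IsLexWeight s w := by
  induction s using Finset.induction_on_min with
  | empty => exact ⟨fun _ => 1, by simp [IsLexWeight]⟩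
  | insert a s ha ih =>
    obtain ⟨w, hw, hlex⟩ := ih
    have has : a ∉ s := fun h => lt_irrefl _ (ha a h)
    have hne : ∀ e ∈ s, e ≠ a := fun e he h => has (h ▸ he)
    have hsum : ∀ s' ⊆ s, ∑ e ∈ s', Function.update w a (1 + ∑ f ∈ s, w f) e = ∑ e ∈ s', w e :=
      fun s' hs' => Finset.sum_congr rfl fun e he => by
        rw [Function.update_of_ne (hne e (hs' he))]
    refine ⟨Function.update w a (1 + ∑ e ∈ s, w e), fun e he => ?_, fun b hb => ?_⟩
    · rcases Finset.mem_insert.1 he with rfl | he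
      · rw [Function.update_self]
        have := Finset.sum_nonneg fun f hf => (hw f hf).le
        linarith
      · rw [Function.update_of_ne (hne e he)]
        exact hw e he
    · rcases Finset.mem_insert.1 hb with rfl | hb
      · rw [Finset.filter_insert, if_neg (lt_irrefl _), Finset.filter_true_of_mem ha,
          hsum s subset_rfl, Function.update_self]
        linarith
      · rw [Finset.filter_insert, if_neg (ha b hb).not_gt, hsum _ (Finset.filter_subset _ _),
          Function.update_of_ne (hne b hb)]
        exact hlex b hb

/-- The worst case is coefficient -1 at every element after `a`, and even then the weight of `a`
dominates. -/
theorem IsLexWeight.sum_pos {s : Finset E} {w : E → ℝ} (hw : IsLexWeight s w) {c : E → ℝ} {a : E}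
    (ha : a ∈ s) (hc : ∀ e ∈ s, -1 ≤ c e) (hca : c a = 1) (h0 : ∀ e ∈ s, e < a → c e = 0) :
    0 < ∑ e ∈ s, c e * w e := by
  have h1 : ∑ e ∈ s, (if e = a then w e else if a < e then - w e else 0) ≤
      ∑ e ∈ s, c e * w e := by
    refine Finset.sum_le_sum fun e he => ?_
    split_ifs with h h'
    · rw [h, hca, one_mul]
    · nlinarith [hc e he, hw.1 e he]
    · rw [h0 e he (lt_of_le_of_ne (not_lt.1 h') h), zero_mul]
  have h2 : ∑ e ∈ s, (if e = a then w e else if a < e then - w e else 0) =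
      w a - ∑ e ∈ s.filter (a < ·), w e := by
    rw [Finset.sum_filter, ← Finset.add_sum_erase _ _ ha, ← Finset.add_sum_erase (a := a) _ _ ha,
      if_pos rfl, if_neg (lt_irrefl _), zero_add, sub_eq_add_neg, ← Finset.sum_neg_distrib]
    congr 1
    refine Finset.sum_congr rfl fun e he => ?_
    rw [if_neg (Finset.ne_of_mem_erase he)]
    split_ifs <;> simp
  have := hw.2 a ha
  linarith

theorem IsLexWeight.sum_ne_zero {s : Finset E} {w : E → ℝ} (hw : IsLexWeight s w) {c : E → ℝ}
    (hc : ∀ e ∈ s, c e = 1 ∨ c e = -1 ∨ c e = 0) (hne : ∃ e ∈ s, c e ≠ 0) :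
    ∑ e ∈ s, c e * w e ≠ 0 := by
  classical
  have hn : (s.filter (c · ≠ 0)).Nonempty := by
    obtain ⟨e, he, h⟩ := hne
    exact ⟨e, Finset.mem_filter.2 ⟨he, h⟩⟩
  have ha := Finset.min'_mem _ hn
  set a := Finset.min' _ hn
  rw [Finset.mem_filter] at ha
  have h0 : ∀ e ∈ s, e < a → c e = 0 := by
    intro e he hea
    by_contra h
    exact absurd (Finset.min'_le _ e (Finset.mem_filter.2 ⟨he, h⟩)) (not_le.2 hea)
  have hb : ∀ e ∈ s, -1 ≤ c e ∧ -1 ≤ - c e := by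
    intro e he
    rcases hc e he with h | h | h <;> rw [h] <;> norm_num
  rcases hc a ha.1 with h | h | h
  · exact (hw.sum_pos ha.1 (fun e he => (hb e he).1) h h0).ne'
  · have := hw.sum_pos (c := fun e => - c e) ha.1 (fun e he => (hb e he).2)
      (by rw [h]; norm_num) (fun e he hea => by rw [h0 e he hea, neg_zero])
    simp only [neg_mul, Finset.sum_neg_distrib] at this
    linarith
  · exact absurd h ha.2

/-- The smallest element of a signed set of nonpositive lexicographic weight is negative. -/
theorem IsLexWeight.exists_isLeast_neg {s : Finset E} {w : E → ℝ} (hw : IsLexWeight s w)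
    {C : SignedEdgeSet E} (hC : C.supp ⊆ s) (hne : C.supp.Nonempty)
    (hsum : ∑ e ∈ s, (C.sign e : ℝ) * w e ≤ 0) :
    ∃ a, IsLeast (C.supp : Set E) a ∧ a ∈ C.neg := by
  refine ⟨C.supp.min' hne, Finset.isLeast_min' _ _, ?_⟩
  have hmem := Finset.min'_mem _ hne
  refine (Finset.mem_union.1 hmem).resolve_left fun hpos => ?_
  refine absurd (hw.sum_pos (hC hmem) (fun e _ => (abs_le.1 (C.abs_sign_le_one e)).1)
    (sign_cast_eq_one_iff.2 hpos) fun e _ he => ?_) (not_lt.2 hsum)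
  rw [sign_cast_eq_zero_iff]
  exact fun h => absurd (Finset.min'_le _ e h) (not_le.2 he)

/-- Lets the lower bound at `p` equal the normalizing value 1, so that `p` is always tight, while
the other bounds become small enough to be satisfiable. -/
theorem IsLexWeight.scale_erase_min {s : Finset E} {w : E → ℝ} (hw : IsLexWeight s w) {p : E}
    (hp : IsLeast (s : Set E) p) {c : ℝ} (hc : 0 < c) (hcs : c * ∑ e ∈ s, w e < 1) :
    IsLexWeight s (fun e => if e = p then 1 else c * w e) := by
  have hsum : ∀ a ∈ s, ∑ e ∈ s.filter (a < ·), (if e = p then 1 else c * w e) =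
      c * ∑ e ∈ s.filter (a < ·), w e := by
    intro a ha
    rw [Finset.mul_sum]
    refine Finset.sum_congr rfl fun e he => if_neg ?_
    rintro rfl
    exact absurd (Finset.mem_filter.1 he).2 (not_lt.2 (hp.2 ha))
  refine ⟨fun e he => ?_, fun a ha => ?_⟩
  · dsimp only
    split_ifs
    · exact one_pos
    · exact mul_pos hc (hw.1 e he)
  · rw [hsum a ha]
    dsimp only
    split_ifs with h
    · refine lt_of_le_of_lt (mul_le_mul_of_nonneg_left ?_ hc.le) hcs
      exact Finset.sum_le_sum_of_subset_of_nonneg (Finset.filter_subset _ _)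
        fun e he _ => (hw.1 e he).le
    · exact mul_lt_mul_of_pos_left (hw.2 a ha) hc

end LexWeights

/-! ### A linear program on normalized tensions -/

section LinearProgram

variable {V E : Type*} {G : MultiDigraph V E} {p : E}

/-- A vertex of minimal potential has no outgoing edge and is therefore the sink; dually, a vertex
of maximal potential is the source. -/
theorem IsBipolar.potential_bounds (hG : G.IsBipolar p) {φ : V → ℝ}
    (hφ : ∀ e ∈ G.edges, φ (G.tgt e) < φ (G.src e)) {v : V} (hv : v ∈ G.verts) :
    φ (G.tgt p) ≤ φ v ∧ φ v ≤ φ (G.src p) := by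
  obtain ⟨-, -, -, hsrc, htgt⟩ := hG
  constructor
  · obtain ⟨m, hm, hmin⟩ := G.verts.exists_min_image φ ⟨v, hv⟩
    have : m = G.tgt p := (htgt m hm).1 fun e he h => by
      have h1 := hφ e he
      have h2 := hmin _ (G.tgt_mem e he)
      rw [h] at h1
      linarith
    exact this ▸ hmin v hv
  · obtain ⟨m, hm, hmax⟩ := G.verts.exists_max_image φ ⟨v, hv⟩
    have : m = G.src p := (hsrc m hm).1 fun e he h => by
      have h1 := hφ e he
      have h2 := hmax _ (G.src_mem e he)
      rw [h] at h1
      linarith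
    exact this ▸ hmax v hv

/-- A linear objective attains its maximum on the tensions bounded below by `δ` and normalized
at `p`. -/
theorem IsBipolar.exists_optimal_tension (hG : G.IsBipolar p) {δ : E → ℝ}
    (hδ : ∀ e ∈ G.edges, 0 < δ e) (w : E → ℝ)
    (hfeas : ∃ x, G.IsTension x ∧ x p = 1 ∧ ∀ e ∈ G.edges, δ e ≤ x e) :
    ∃ x, G.IsTension x ∧ x p = 1 ∧ (∀ e ∈ G.edges, δ e ≤ x e) ∧
      ∀ z, G.IsTension z → z p = 1 → (∀ e ∈ G.edges, δ e ≤ z e) →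
        ∑ e ∈ G.edges, z e * w e ≤ ∑ e ∈ G.edges, x e * w e := by
  classical
  -- Feasible potentials, shifted to vanish at the sink, lie in the unit cube by `potential_bounds`.
  -- Points outside `G.verts` get the value 0, so Tychonoff's theorem gives compactness whatever the
  -- type `V`.
  let K : Set (V → ℝ) := (Set.univ.pi fun _ => Set.Icc (0 : ℝ) 1) ∩
    ({φ | φ (G.src p) - φ (G.tgt p) = 1} ∩
      ⋂ e ∈ G.edges, {φ | δ e ≤ φ (G.src e) - φ (G.tgt e)})
  have hK : IsCompact K := by
    refine (isCompact_univ_pi fun _ => isCompact_Icc).inter_right (IsClosed.inter ?_ ?_)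
    · exact isClosed_eq (by fun_prop) continuous_const
    · exact isClosed_biInter fun e _ => isClosed_le continuous_const (by fun_prop)
  have hnorm : ∀ z, G.IsTension z → z p = 1 → (∀ e ∈ G.edges, δ e ≤ z e) →
      ∃ φ ∈ K, ∀ e ∈ G.edges, z e = φ (G.src e) - φ (G.tgt e) := by
    rintro z ⟨φ, hφ⟩ hzp hz
    have hpe := hG.2.2.1
    have hdiff : ∀ e ∈ G.edges, z e = (if G.src e ∈ G.verts then φ (G.src e) - φ (G.tgt p) else 0) -
        (if G.tgt e ∈ G.verts then φ (G.tgt e) - φ (G.tgt p) else 0) := by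
      intro e he
      rw [if_pos (G.src_mem e he), if_pos (G.tgt_mem e he), hφ]
      ring
    refine ⟨fun v => if v ∈ G.verts then φ v - φ (G.tgt p) else 0, ⟨fun v _ => ?_, ?_, ?_⟩, hdiff⟩
    · simp only
      split_ifs with hv
      · have hb := hG.potential_bounds (φ := φ) (fun e he => by
          have h1 := hz e he
          have h2 := hδ e he
          rw [hφ] at h1
          linarith) hv
        rw [hφ] at hzp
        constructor <;> linarith
      · simp
    · exact (hdiff p hpe).symm.trans hzp
    · rw [Set.mem_iInter₂]
      intro e he
      exact (hz e he).trans_eq (hdiff e he)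
  have hsum : ∀ (z : E → ℝ) (φ : V → ℝ), (∀ e ∈ G.edges, z e = φ (G.src e) - φ (G.tgt e)) →
      ∑ e ∈ G.edges, z e * w e = ∑ e ∈ G.edges, (φ (G.src e) - φ (G.tgt e)) * w e :=
    fun z φ h => Finset.sum_congr rfl fun e he => by rw [h e he]
  obtain ⟨x₀, hx₀, hx₀p, hx₀δ⟩ := hfeas
  obtain ⟨φ₀, hφ₀, -⟩ := hnorm x₀ hx₀ hx₀p hx₀δ
  obtain ⟨φ, hφ, hmax⟩ := hK.exists_isMaxOn ⟨φ₀, hφ₀⟩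
    (f := fun φ => ∑ e ∈ G.edges, (φ (G.src e) - φ (G.tgt e)) * w e)
    (Continuous.continuousOn (by fun_prop))
  refine ⟨fun e => φ (G.src e) - φ (G.tgt e), ⟨φ, fun _ => rfl⟩, hφ.2.1,
    fun e he => Set.mem_iInter₂.1 hφ.2.2 e he, fun z hz hzp hzδ => ?_⟩
  obtain ⟨ψ, hψ, hzψ⟩ := hnorm z hz hzp hzδ
  rw [hsum z ψ hzψ]
  exact hmax hψ

end LinearProgram

/-- A direction is feasible as soon as it does not violate the tight constraints, there being
finitely many. Applied to slacks `u` and directions `y`. -/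
theorem exists_small_step {E : Type*} (s : Finset E) {u y : E → ℝ} (hu : ∀ e ∈ s, 0 ≤ u e)
    (h : ∀ e ∈ s, u e = 0 → 0 ≤ y e) : ∃ τ : ℝ, 0 < τ ∧ ∀ e ∈ s, 0 ≤ u e + τ * y e := by
  have key : ∀ᶠ τ : ℝ in nhdsWithin 0 (Set.Ioi 0), ∀ e ∈ s, 0 ≤ u e + τ * y e := by
    rw [Filter.eventually_all_finset]
    intro e he
    rcases (hu e he).eq_or_lt with h0 | h0
    · filter_upwards [self_mem_nhdsWithin] with τ hτ
      rw [← h0, zero_add]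
      exact mul_nonneg (le_of_lt hτ) (h e he h0.symm)
    · have : Filter.Tendsto (fun τ : ℝ => u e + τ * y e) (nhdsWithin 0 (Set.Ioi 0))
          (nhds (u e + 0 * y e)) :=
        (Continuous.tendsto (by fun_prop) 0).mono_left nhdsWithin_le_nhds
      rw [zero_mul, add_zero] at this
      filter_upwards [this.eventually (lt_mem_nhds h0)] with τ hτ using hτ.le
  obtain ⟨τ, hτ, hτ0⟩ := (key.and self_mem_nhdsWithin).exists
  exact ⟨τ, hτ0, hτ⟩

/-! ### Existence of the fully optimal tree -/

section Existence

variable {V E : Type*} [LinearOrder E] {G : MultiDigraph V E} {p : E}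

theorem IsBipolar.exists_isFullyOptimal (hp : IsLeast (G.edges : Set E) p) (hG : G.IsBipolar p) :
    ∃ T, G.IsFullyOptimal p T := by
  classical
  obtain ⟨w, hw⟩ := exists_isLexWeight G.edges
  obtain ⟨x₁, hx₁, hx₁pos⟩ := hG.2.1.exists_tension
  have hpe : p ∈ G.edges := hG.2.2.1
  have hx₁p := hx₁pos p hpe
  -- The scale `c` is small enough for two purposes: the normalized positive tension `x₁` satisfies
  -- the bounds, and the bound 1 at `p` outweighs all the others together.
  obtain ⟨c, hc, hcw, hcs⟩ : ∃ c : ℝ, 0 < c ∧ (∀ e ∈ G.edges, c * w e ≤ (x₁ p)⁻¹ * x₁ e) ∧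
      c * ∑ e ∈ G.edges, w e < 1 := by
    obtain ⟨τ, hτ, hτe⟩ := exists_small_step G.edges
      (u := fun e => (x₁ p)⁻¹ * x₁ e) (y := fun e => - w e)
      (fun e he => (mul_pos (inv_pos.2 hx₁p) (hx₁pos e he)).le)
      (fun e he h => absurd h (mul_pos (inv_pos.2 hx₁p) (hx₁pos e he)).ne')
    have hW : 0 ≤ ∑ e ∈ G.edges, w e := Finset.sum_nonneg fun e he => (hw.1 e he).le
    refine ⟨min τ (1 + ∑ e ∈ G.edges, w e)⁻¹, lt_min hτ (by positivity), fun e he => ?_, ?_⟩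
    · have h1 := hτe e he
      have h2 := mul_le_mul_of_nonneg_right (min_le_left τ (1 + ∑ e ∈ G.edges, w e)⁻¹)
        (hw.1 e he).le
      linarith
    · refine lt_of_le_of_lt (mul_le_mul_of_nonneg_right (min_le_right _ _) hW) ?_
      rw [inv_mul_lt_iff₀ (by positivity)]
      linarith
  set δ : E → ℝ := fun e => if e = p then 1 else c * w e with hδdef
  have hδ : IsLexWeight G.edges δ := hw.scale_erase_min hp hc hcs
  have hδp : δ p = 1 := if_pos rfl
  obtain ⟨x, hx, hxp, hxδ, hmax⟩ := hG.exists_optimal_tension hδ.1 w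
    ⟨fun e => (x₁ p)⁻¹ * x₁ e, hx₁.const_mul _, inv_mul_cancel₀ hx₁p.ne', fun e he => by
      by_cases hep : e = p
      · rw [hep, hδp]; exact (inv_mul_cancel₀ hx₁p.ne').ge
      · rw [hδdef]; simp only [if_neg hep]; exact hcw e he⟩
  let T := G.edges.filter fun e => x e = δ e
  have hTE : T ⊆ G.edges := Finset.filter_subset _ _
  have hpT : p ∈ T := Finset.mem_filter.2 ⟨hpe, by rw [hxp, hδp]⟩
  -- Such `y` are feasible directions at the maximizer, so they cannot increase the objective.
  have hmove : ∀ y, G.IsTension y → y p = 0 → (∀ b ∈ T, 0 ≤ y b) →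
      ∑ e ∈ G.edges, y e * w e ≤ 0 := by
    intro y hy hyp hyT
    obtain ⟨τ, hτ, hτe⟩ := exists_small_step G.edges (u := fun e => x e - δ e) (y := y)
      (fun e he => sub_nonneg.2 (hxδ e he))
      (fun e he h => hyT e (Finset.mem_filter.2 ⟨he, sub_eq_zero.1 h⟩))
    have h := hmax (fun e => x e + τ * y e) (hx.add (hy.const_mul τ)) (by rw [hxp, hyp]; ring)
      (fun e he => by have := hτe e he; linarith)
    simp only [add_mul, Finset.sum_add_distrib, mul_assoc, ← Finset.mul_sum] at h
    by_contra hlt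
    have := mul_pos hτ (not_le.1 hlt)
    linarith
  -- On a cycle of tight edges, orthogonality to `x` would make a nontrivial signed sum of the `δ e`
  -- vanish, against their lexicographic growth.
  have hcyc : ∀ C, G.IsSignedCycle C → ¬ C.supp ⊆ T := by
    intro C hC hCT
    refine hδ.sum_ne_zero (c := fun e => (C.sign e : ℝ)) (fun e _ => ?_) ?_ ?_
    · rw [sign_cast_eq_one_iff, sign_cast_eq_neg_one_iff, sign_cast_eq_zero_iff]
      unfold SignedEdgeSet.supp
      rw [Finset.mem_union]
      tauto
    · obtain ⟨e, he⟩ := hC.supp_nonempty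
      exact ⟨e, hTE (hCT he), fun h => sign_cast_eq_zero_iff.1 h he⟩
    · rw [← hC.sum_eq_zero hx]
      refine (Finset.sum_subset hC.supp_subset fun e _ he => ?_).symm.trans ?_
      · rw [sign_cast_eq_zero_iff.2 he, zero_mul]
      · exact Finset.sum_congr rfl fun e he => by rw [(Finset.mem_filter.1 (hCT he)).2]
  have hconn : (G.restrict T).Connected := by
    refine ⟨hG.1.1, fun u hu v hv => ?_⟩
    by_contra hv'
    let R : Set V := {v | ∃ l, (G.restrict T).IsWalk u l v}
    have hRT : ∀ b ∈ T, G.cutTension R b = 0 := by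
      intro b hb
      have hb' : b ∈ (G.restrict T).edges := Finset.mem_inter.2 ⟨hTE hb, hb⟩
      rw [cutTension_eq_zero_iff]
      constructor
      · rintro ⟨l, hl⟩
        exact ⟨l ++ [(b, true)], hl.append ⟨hb', rfl, rfl⟩⟩
      · rintro ⟨l, hl⟩
        exact ⟨l ++ [(b, false)], hl.append ⟨hb', rfl, rfl⟩⟩
    -- A cut missing `T` gives a direction that is feasible both ways, so its `w`-weight is 0; this
    -- is impossible for a nonempty cut.
    refine hw.sum_ne_zero (c := G.cutTension R) (fun e _ => cutTension_trichotomy _ _) ?_ ?_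
    · by_contra h
      push Not at h
      have := (connected_iff.1 hG.1).2 (fun v => if v ∈ R then 1 else 0) (fun e he => by
        have := cutTension_eq_zero_iff.1 (h e he)
        simp only [this]) u hu v hv
      simp only [if_pos (show u ∈ R from ⟨[], rfl⟩), if_neg (show v ∉ R from hv')] at this
      norm_num at this
    · have hR := isTension_cutTension (G := G) R
      refine le_antisymm (hmove _ hR (hRT p hpT) fun b hb => (hRT b hb).ge) ?_
      have := hmove _ (hR.const_mul (-1)) (by rw [hRT p hpT, mul_zero])
        fun b hb => by rw [hRT b hb, mul_zero]
      simp only [neg_mul, one_mul, Finset.sum_neg_distrib] at this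
      linarith
  have hT : G.IsSpanningTree T := ⟨hTE, hconn, fun ⟨C, hC, hCT⟩ => hcyc C hC hCT⟩
  refine ⟨T, hT, fun b hb hbp => ?_, fun e he heT => ?_⟩
  · obtain ⟨S, hS1, hS0⟩ := hT.exists_cut hb
    have hC := hT.isFundCocycle_signedCut hb hS1 hS0
    refine ⟨_, hC, hw.exists_isLeast_neg hC.1.supp_subset
      ⟨b, Finset.mem_union_left _ hC.2.1⟩ ?_⟩
    rw [Finset.sum_congr rfl fun e he => by rw [sign_eq_cutTension (S := S) rfl rfl he]]
    refine hmove _ (isTension_cutTension S) (hS0 p hpT (Ne.symm hbp)) fun b' hb' => ?_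
    by_cases h : b' = b
    · rw [h, hS1]; norm_num
    · rw [hS0 b' hb' h]
  · obtain ⟨C, hC⟩ := hT.exists_fundCycle he heT
    refine ⟨C, hC, hδ.exists_isLeast_neg hC.1.supp_subset hC.1.supp_nonempty ?_⟩
    have h0 := hC.1.sum_eq_zero hx
    rw [Finset.sum_subset hC.1.supp_subset
      (fun f _ hf => by rw [sign_cast_eq_zero_iff.2 hf, zero_mul])] at h0
    rw [← h0]
    -- The sums for `δ` and `x` differ only at `e`, whose sign is +1 and where `δ e ≤ x e`.
    refine Finset.sum_le_sum fun f hf => ?_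
    by_cases hfT : f ∈ T
    · rw [(Finset.mem_filter.1 hfT).2]
    · by_cases hfe : f = e
      · rw [hfe, sign_cast_eq_one_iff.2 hC.2.1, one_mul, one_mul]
        exact hxδ e he
      · rw [sign_cast_eq_zero_iff.2, zero_mul, zero_mul]
        intro hmem
        rcases Finset.mem_insert.1 (hC.2.2 hmem) with h | h
        · exact hfe h
        · exact hfT h

end Existence

end MultiDigraph

namespace MultiDigraph

/-! ### Pivots of spaces of tensions and their exchange -/

section Pivots

variable {V E : Type*} [LinearOrder E] {G : MultiDigraph V E} {P : Finset E}

open Classical in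
/-- The smallest elements of the supports of the nonzero tensions that vanish on `P`. -/
noncomputable def pivots (G : MultiDigraph V E) (P : Finset E) : Finset E :=
  G.edges.filter fun m => ∃ y, G.IsTension y ∧ (∀ b ∈ P, y b = 0) ∧ y m ≠ 0 ∧
    ∀ e ∈ G.edges, e < m → y e = 0

theorem mem_pivots {m : E} : m ∈ G.pivots P ↔ m ∈ G.edges ∧ ∃ y, G.IsTension y ∧
    (∀ b ∈ P, y b = 0) ∧ y m ≠ 0 ∧ ∀ e ∈ G.edges, e < m → y e = 0 := by
  simp [pivots]

theorem pivots_subset : G.pivots P ⊆ G.edges := fun _ h => (mem_pivots.1 h).1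

theorem notMem_pivots {b : E} (hb : b ∈ P) : b ∉ G.pivots P := fun h => by
  obtain ⟨-, y, -, h0, hne, -⟩ := mem_pivots.1 h
  exact hne (h0 b hb)

theorem exists_min_support {y : E → ℝ} (h : ∃ e ∈ G.edges, y e ≠ 0) :
    ∃ m ∈ G.edges, y m ≠ 0 ∧ ∀ e ∈ G.edges, e < m → y e = 0 := by
  classical
  have hn : (G.edges.filter (y · ≠ 0)).Nonempty := by
    obtain ⟨e, he, h⟩ := h
    exact ⟨e, Finset.mem_filter.2 ⟨he, h⟩⟩
  have hm := Finset.mem_filter.1 (Finset.min'_mem _ hn)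
  refine ⟨_, hm.1, hm.2, fun e he hlt => ?_⟩
  by_contra hne
  exact absurd (Finset.min'_le _ e (Finset.mem_filter.2 ⟨he, hne⟩)) (not_le.2 hlt)

theorem exists_pivot {y : E → ℝ} (hy : G.IsTension y) (hP : ∀ b ∈ P, y b = 0)
    (h : ∃ e ∈ G.edges, y e ≠ 0) :
    ∃ m ∈ G.pivots P, y m ≠ 0 ∧ ∀ e ∈ G.edges, e < m → y e = 0 := by
  obtain ⟨m, hm, hne, h0⟩ := exists_min_support h
  exact ⟨m, mem_pivots.2 ⟨hm, y, hy, hP, hne, h0⟩, hne, h0⟩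

/-- `m` is the pivot lost when tensions that vanish on `P` are required to vanish at `t` too. -/
def IsExchange (G : MultiDigraph V E) (P : Finset E) (t m : E) : Prop :=
  (m ∈ G.edges ∧ ∃ y, G.IsTension y ∧ (∀ b ∈ P, y b = 0) ∧ y m ≠ 0 ∧
    (∀ e ∈ G.edges, e < m → y e = 0) ∧ y t ≠ 0) ∧
  ∀ y, G.IsTension y → (∀ b ∈ P, y b = 0) → (∀ e ∈ G.edges, e ≤ m → y e = 0) → y t = 0

theorem IsExchange.mem {t m : E} (h : G.IsExchange P t m) : m ∈ G.pivots P := by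
  obtain ⟨⟨hm, y, hy, hyP, hym, hy0, -⟩, -⟩ := h
  exact mem_pivots.2 ⟨hm, y, hy, hyP, hym, hy0⟩

theorem isExchange_self {t : E} (ht : t ∈ G.pivots P) : G.IsExchange P t t := by
  obtain ⟨hte, y, hy, hyP, hyt, hy0⟩ := mem_pivots.1 ht
  exact ⟨⟨hte, y, hy, hyP, hyt, hy0, hyt⟩, fun z _ _ hz => hz t hte le_rfl⟩

/-- Gaussian elimination with the witness `y` of pivot `m`. A tension with pivot before `m` is
corrected by a multiple of `y` so as to vanish at `t`; one with pivot after `m` vanishes at `t`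
already; one with pivot `m` and value 0 at `t` would combine with `y` to contradict the second
clause of `IsExchange`. -/
theorem IsExchange.pivots_insert {t m : E} (h : G.IsExchange P t m) :
    G.pivots (insert t P) = (G.pivots P).erase m := by
  obtain ⟨⟨hm, y, hy, hyP, hym, hy0, hyt⟩, hb⟩ := h
  ext f
  rw [Finset.mem_erase, mem_pivots, mem_pivots]
  constructor
  · rintro ⟨hf, z, hz, hzP, hzf, hz0⟩
    refine ⟨?_, hf, z, hz, fun b hb' => hzP b (Finset.mem_insert_of_mem hb'), hzf, hz0⟩
    rintro rfl
    have h1 := hb (fun e => z f * y e - y f * z e) ((hy.const_mul _).sub (hz.const_mul _))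
      (fun b hb' => by rw [hyP b hb', hzP b (Finset.mem_insert_of_mem hb')]; ring)
      (fun e he hle => by
        rcases hle.lt_or_eq with hlt | rfl
        · rw [hy0 e he hlt, hz0 e he hlt]; ring
        · ring)
    simp only [hzP t (Finset.mem_insert_self _ _), mul_zero, sub_zero] at h1
    exact mul_ne_zero hzf hyt h1
  · rintro ⟨hfm, hf, z, hz, hzP, hzf, hz0⟩
    refine ⟨hf, ?_⟩
    rcases lt_or_gt_of_ne hfm with hlt | hlt
    · refine ⟨fun e => y t * z e - z t * y e, (hz.const_mul _).sub (hy.const_mul _), ?_, ?_, ?_⟩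
      · intro b hb'
        rcases Finset.mem_insert.1 hb' with rfl | hb'
        · ring
        · simp only [hyP b hb', hzP b hb', mul_zero, sub_zero]
      · simp only [hy0 f hf hlt, mul_zero, sub_zero]
        exact mul_ne_zero hyt hzf
      · intro e he hef
        simp only [hz0 e he hef, hy0 e he (hef.trans hlt), mul_zero, sub_zero]
    · refine ⟨z, hz, ?_, hzf, hz0⟩
      intro b hb'
      rcases Finset.mem_insert.1 hb' with rfl | hb'
      · exact hb z hz hzP fun e he hle => hz0 e he (hle.trans_lt hlt)
      · exact hzP b hb'

/-- The pivots of the space of all tensions form the lexicographically smallest spanning tree. -/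
theorem isLexMinSpanningTree_iff {B₀ : Finset E} (hB₀ : G.IsSpanningTree B₀)
    (hpiv : G.pivots ∅ = B₀) {B : Finset E} : G.IsLexMinSpanningTree B ↔ B = B₀ := by
  have hmin : G.IsLexMinSpanningTree B₀ := by
    refine ⟨hB₀, fun T' hT' hne => ?_⟩
    have hn : (symmDiff B₀ T').Nonempty := by
      rw [Finset.nonempty_iff_ne_empty]
      exact fun h => hne (symmDiff_eq_bot.1 h).symm
    have hlt : ∀ e, e < (symmDiff B₀ T').min' hn → (e ∈ B₀ ↔ e ∈ T') := by
      intro e he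
      by_contra h
      refine absurd (Finset.min'_le _ e ?_) (not_le.2 he)
      rw [Finset.mem_symmDiff]
      tauto
    have hmem := Finset.min'_mem _ hn
    set e := (symmDiff B₀ T').min' hn with hedef
    have hle : ∀ f ∈ T' \ B₀, e ≤ f := fun f hf =>
      Finset.min'_le _ f (Finset.mem_symmDiff.2 (Or.inr (Finset.mem_sdiff.1 hf)))
    rcases Finset.mem_symmDiff.1 hmem with h | h
    · refine ⟨e, Finset.mem_sdiff.2 h, fun f hf => lt_of_le_of_ne (hle f hf) ?_⟩
      rintro rfl
      exact (Finset.mem_sdiff.1 hf).2 h.1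
    -- Here the first difference `e` lies in `T'` only. The cut of `T'` at `e` has its pivot in
    -- `B₀`, hence strictly before `e`, hence in `T'`, where this cut vanishes.
    · exfalso
      obtain ⟨S, hS1, hS0⟩ := hT'.exists_cut h.1
      obtain ⟨m, hm, hne, h0⟩ := exists_pivot (P := ∅) (isTension_cutTension S) (by simp)
        ⟨e, hT'.1 h.1, by rw [hS1]; norm_num⟩
      rw [hpiv] at hm
      have hme : m ≤ e := by
        by_contra hlt'
        have := h0 e (hT'.1 h.1) (not_le.1 hlt')
        rw [hS1] at this
        norm_num at this
      have hne' : m ≠ e := fun h' => h.2 (h' ▸ hm)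
      exact hne (hS0 m ((hlt m (lt_of_le_of_ne hme hne')).1 hm) hne')
  constructor
  · rintro ⟨hB, hB'⟩
    by_contra hne
    obtain ⟨e, he, he'⟩ := hB' B₀ hB₀ (Ne.symm hne)
    obtain ⟨f, hf, hf'⟩ := hmin.2 B hB hne
    exact lt_asymm (he' f hf) (hf' e he)
  · rintro rfl
    exact hmin

end Pivots

/-! ### Dual tensions of a fully optimal tree -/

/-- `x b`, for `b ∈ T`, is the tension dual to `b` in the fully optimal spanning tree `T`. -/
structure IsOptimalDual {V E : Type*} [LinearOrder E] (G : MultiDigraph V E) (p : E)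
    (T : Finset E) (x : E → E → ℝ) : Prop where
  isLeast : IsLeast (G.edges : Set E) p
  tree : G.IsSpanningTree T
  tension : ∀ b ∈ T, G.IsTension (x b)
  self : ∀ b ∈ T, x b b = 1
  other : ∀ b ∈ T, ∀ b' ∈ T, b' ≠ b → x b b' = 0
  internal : ∀ b ∈ T, b ≠ p → ∃ a ∈ G.edges, x b a = -1 ∧ ∀ e ∈ G.edges, e < a → x b e = 0
  external : ∀ e ∈ G.edges, ∃ b ∈ T, b ≤ e ∧ x b e = 1 ∧ ∀ b' ∈ T, b' < b → x b' e = 0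

section Dual

variable {V E : Type*} [LinearOrder E] {G : MultiDigraph V E} {p : E} {T : Finset E}
  {x : E → E → ℝ}

theorem IsFullyOptimal.exists_dual (hp : IsLeast (G.edges : Set E) p)
    (hT : G.IsFullyOptimal p T) : ∃ x, G.IsOptimalDual p T x := by
  obtain ⟨hT, hint, hext⟩ := hT
  choose! S hS1 hS0 using fun b (hb : b ∈ T) => hT.exists_cut hb
  refine ⟨fun b => G.cutTension (S b), hp, hT, fun b _ => isTension_cutTension _, hS1, hS0,
    fun b hb hbp => ?_, fun e he => ?_⟩
  · obtain ⟨C, hC, a, ha, hneg⟩ := hint b hb hbp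
    have hsign := fun {e} => hC.sign_eq hT hb (isTension_cutTension _) (hS1 b hb) (hS0 b hb)
      (e := e)
    have hae := hC.1.supp_subset ha.1
    refine ⟨a, hae, ?_, fun e he hea => ?_⟩
    · rw [← hsign hae, sign_cast_eq_neg_one_iff]; exact hneg
    · rw [← hsign he, sign_cast_eq_zero_iff]
      exact fun h => absurd (ha.2 h) (not_le.2 hea)
  · by_cases heT : e ∈ T
    · exact ⟨e, heT, le_rfl, hS1 e heT, fun b hb hbe => hS0 b hb e heT hbe.ne'⟩
    · obtain ⟨C, hC, a, ha, hneg⟩ := hext e he heT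
      have hsign := fun {b} (hb : b ∈ T) => hC.sign_eq heT hb (isTension_cutTension _)
        (hS1 b hb) (hS0 b hb)
      have hle : a ≤ e := ha.2 (Finset.mem_union_left _ hC.2.1)
      have haT : a ∈ T := by
        refine (Finset.mem_insert.1 (hC.2.2 ha.1)).resolve_left ?_
        rintro rfl
        exact Finset.disjoint_left.1 C.disj hC.2.1 hneg
      refine ⟨a, haT, hle, ?_, fun b hb hba => ?_⟩
      · have := hsign haT
        rw [sign_cast_eq_neg_one_iff.2 hneg] at this
        linarith
      · have := hsign hb
        rw [sign_cast_eq_zero_iff.2 fun h => absurd (ha.2 h) (not_le.2 hba)] at this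
        linarith

/-- The edges on which the dual tensions of the tree edges smaller than `t` vanish. -/
noncomputable def dualGround (G : MultiDigraph V E) (T : Finset E) (x : E → E → ℝ) (t : E) :
    Finset E :=
  open Classical in G.edges.filter fun e => ∀ b ∈ T, b < t → x b e = 0

theorem mem_dualGround {t e : E} :
    e ∈ G.dualGround T x t ↔ e ∈ G.edges ∧ ∀ b ∈ T, b < t → x b e = 0 := by
  simp [dualGround]

namespace IsOptimalDual

theorem expand (D : G.IsOptimalDual p T x) {y : E → ℝ} (hy : G.IsTension y) {e : E}
    (he : e ∈ G.edges) : y e = ∑ b ∈ T, y b * x b e := by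
  rw [← sub_eq_zero]
  refine D.tree.eq_zero (hy.sub (isTension_sum T fun b hb => (D.tension b hb).const_mul (y b)))
    (fun b hb => ?_) e he
  rw [Finset.sum_eq_single b, D.self b hb, mul_one, sub_self]
  · intro b' hb' hne
    rw [D.other b' hb' b hb hne.symm, mul_zero]
  · exact fun h => absurd hb h

theorem mem_edges (D : G.IsOptimalDual p T x) {b : E} (hb : b ∈ T) : b ∈ G.edges := D.tree.1 hb

theorem le_of_mem (D : G.IsOptimalDual p T x) {b : E} (hb : b ∈ T) : p ≤ b :=
  D.isLeast.2 (D.tree.1 hb)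

theorem min_mem (D : G.IsOptimalDual p T x) : p ∈ T := by
  obtain ⟨b, hb, hle, -⟩ := D.external p D.isLeast.1
  rwa [le_antisymm (D.le_of_mem hb) hle]

theorem mem_ground (D : G.IsOptimalDual p T x) {t b : E} (hb : b ∈ T) (hle : t ≤ b) :
    b ∈ G.dualGround T x t :=
  mem_dualGround.2 ⟨D.mem_edges hb, fun b' hb' hlt =>
    D.other b' hb' b hb (hlt.trans_le hle).ne'⟩

theorem exists_of_mem_ground (D : G.IsOptimalDual p T x) {t e : E} (he : e ∈ G.dualGround T x t) :
    ∃ b ∈ T, t ≤ b ∧ b ≤ e ∧ x b e = 1 ∧ ∀ b' ∈ T, b' < b → x b' e = 0 := by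
  obtain ⟨he, h⟩ := mem_dualGround.1 he
  obtain ⟨b, hb, hle, h1, h0⟩ := D.external e he
  refine ⟨b, hb, ?_, hle, h1, h0⟩
  by_contra hlt
  rw [h b hb (not_le.1 hlt)] at h1
  norm_num at h1

theorem isLeast_ground (D : G.IsOptimalDual p T x) {t : E} (ht : t ∈ T) :
    IsLeast (G.dualGround T x t : Set E) t := by
  refine ⟨D.mem_ground ht le_rfl, fun e he => ?_⟩
  obtain ⟨b, -, htb, hbe, -⟩ := D.exists_of_mem_ground he
  exact htb.trans hbe

/-- On the ground set `t` is the first tree edge whose dual tension may be nonzero, and the first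
nonzero entry at an edge is 1. This is why the cocycle of `t` is directed there. -/
theorem nonneg_on_ground (D : G.IsOptimalDual p T x) {t e : E} (ht : t ∈ T)
    (he : e ∈ G.dualGround T x t) : x t e = 1 ∨ x t e = 0 := by
  obtain ⟨b, hb, htb, -, h1, h0⟩ := D.exists_of_mem_ground he
  rcases htb.lt_or_eq with hlt | rfl
  · exact Or.inr (h0 t ht hlt)
  · exact Or.inl h1

end IsOptimalDual

/-! ### The minors met by the algorithm -/

/-- `H` is the minor of `G` considered by the algorithm when the infinity edge is `t`. -/
structure IsMinorAt (G : MultiDigraph V E) (T : Finset E) (x : E → E → ℝ)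
    (H : MultiDigraph V E) (t : E) : Prop where
  connected : H.Connected
  edges_eq : H.edges = G.dualGround T x t ∪ G.pivots (T.filter (· ≤ t))
  tension_iff : ∀ y, H.IsTension y ↔ G.IsTension y ∧ ∀ b ∈ T, b < t → y b = 0

namespace IsMinorAt

variable {H : MultiDigraph V E} {t : E}

theorem edges_subset (M : IsMinorAt G T x H t) : H.edges ⊆ G.edges := by
  rw [M.edges_eq]
  exact Finset.union_subset (fun e he => (mem_dualGround.1 he).1) pivots_subset

theorem ground_subset (M : IsMinorAt G T x H t) : G.dualGround T x t ⊆ H.edges := by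
  rw [M.edges_eq]; exact Finset.subset_union_left

theorem pivots_subset_edges (M : IsMinorAt G T x H t) :
    G.pivots (T.filter (· ≤ t)) ⊆ H.edges := by
  rw [M.edges_eq]; exact Finset.subset_union_right

theorem isTension_dual (M : IsMinorAt G T x H t) (D : G.IsOptimalDual p T x) {b : E}
    (hb : b ∈ T) (hle : t ≤ b) : H.IsTension (x b) :=
  (M.tension_iff _).2 ⟨D.tension b hb, fun b' hb' hlt =>
    D.other b hb b' hb' (hlt.trans_le hle).ne⟩

theorem acyclic (M : IsMinorAt G T x H t) (D : G.IsOptimalDual p T x) :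
    (H.restrict (G.dualGround T x t)).Acyclic := by
  classical
  refine acyclic_of_tension fun C ⟨e₀, he₀⟩ hsub => ?_
  -- The first dual tension that is not identically zero on the candidate cycle takes only the
  -- values 0 and 1 there, so it rules the cycle out.
  let A := T.filter fun b => ∃ e ∈ C.supp, x b e ≠ 0
  have hA : A.Nonempty := by
    obtain ⟨b, hb, -, -, h1, -⟩ := D.exists_of_mem_ground (hsub he₀)
    exact ⟨b, Finset.mem_filter.2 ⟨hb, e₀, he₀, by rw [h1]; norm_num⟩⟩
  obtain ⟨hbT, e, he, hne⟩ := Finset.mem_filter.1 (Finset.min'_mem _ hA)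
  set b := A.min' hA with hbdef
  have hval : ∀ f ∈ C.supp, x b f = 1 ∨ x b f = 0 := by
    intro f hf
    refine D.nonneg_on_ground hbT (mem_dualGround.2
      ⟨(mem_dualGround.1 (hsub hf)).1, fun b' hb' hlt => ?_⟩)
    by_contra hne'
    exact absurd (Finset.min'_le _ b' (Finset.mem_filter.2 ⟨hb', f, hf, hne'⟩)) (not_le.2 hlt)
  refine ⟨x b, M.isTension_dual D hbT ?_, fun f hf => ?_, e, he, ?_⟩
  · by_contra hlt
    exact hne ((mem_dualGround.1 (hsub he)).2 b hbT (not_le.1 hlt))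
  · rcases hval f hf with h | h <;> rw [h]; norm_num
  · rw [(hval e he).resolve_right hne]; norm_num

theorem eq_zero (M : IsMinorAt G T x H t) (D : G.IsOptimalDual p T x) {y : E → ℝ}
    (hy : H.IsTension y) (h : ∀ b ∈ T.filter (t ≤ ·), y b = 0) : ∀ e ∈ G.edges, y e = 0 := by
  obtain ⟨hyG, hy0⟩ := (M.tension_iff y).1 hy
  refine D.tree.eq_zero hyG fun b hb => ?_
  rcases lt_or_ge b t with hlt | hle
  · exact hy0 b hb hlt
  · exact h b (Finset.mem_filter.2 ⟨hb, hle⟩)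

theorem isSpanningTree_filter (M : IsMinorAt G T x H t) (D : G.IsOptimalDual p T x) :
    H.IsSpanningTree (T.filter (t ≤ ·)) := by
  refine isSpanningTree_of M.connected (fun b hb => ?_)
    (fun y hy h e he => M.eq_zero D hy h e (M.edges_subset he)) fun C hC hsub => ?_
  · obtain ⟨hb, hle⟩ := Finset.mem_filter.1 hb
    exact M.ground_subset (D.mem_ground hb hle)
  · obtain ⟨b, hb⟩ := hC.supp_nonempty
    obtain ⟨hbT, hle⟩ := Finset.mem_filter.1 (hsub hb)
    have h := hC.sum_eq_zero (M.isTension_dual D hbT hle)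
    rw [Finset.sum_eq_single b, D.self b hbT, mul_one, sign_cast_eq_zero_iff] at h
    · exact h hb
    · intro b' hb' hne
      rw [D.other b hbT b' (Finset.mem_filter.1 (hsub hb')).1 hne, mul_zero]
    · exact fun h => absurd hb h

/-- A tension of the minor vanishing at `t` and at all pivots has no pivot, hence is 0. A cycle
containing pivots is refuted by the witness of its greatest one, which vanishes on the rest of the
cycle; a loop at `t` is refuted by `x t`. -/
theorem isSpanningTree_pivots (M : IsMinorAt G T x H t) (D : G.IsOptimalDual p T x)
    (ht : t ∈ T) : H.IsSpanningTree (insert t (G.pivots (T.filter (· ≤ t)))) := by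
  have hsplit : ∀ {y : E → ℝ}, (∀ b ∈ T, b < t → y b = 0) → y t = 0 →
      ∀ b ∈ T.filter (· ≤ t), y b = 0 := by
    intro y h0 h1 b hb
    obtain ⟨hb, hle⟩ := Finset.mem_filter.1 hb
    rcases hle.lt_or_eq with hlt | rfl
    · exact h0 b hb hlt
    · exact h1
  refine isSpanningTree_of M.connected ?_ (fun y hy h e he => ?_) fun C hC hsub => ?_
  · rw [Finset.insert_subset_iff]
    exact ⟨M.ground_subset (D.mem_ground ht le_rfl), M.pivots_subset_edges⟩
  · obtain ⟨hyG, hy0⟩ := (M.tension_iff y).1 hy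
    by_contra hne
    obtain ⟨m, hm, hne', -⟩ := exists_pivot hyG (hsplit hy0 (h t (Finset.mem_insert_self _ _)))
      ⟨e, M.edges_subset he, hne⟩
    exact hne' (h m (Finset.mem_insert_of_mem hm))
  · by_cases hn : (C.supp ∩ G.pivots (T.filter (· ≤ t))).Nonempty
    · have hm := Finset.mem_inter.1 (Finset.max'_mem _ hn)
      have hmax := fun f hf => Finset.le_max' (C.supp ∩ G.pivots (T.filter (· ≤ t))) f hf
      set m := Finset.max' _ hn
      obtain ⟨hme, y, hy, hyP, hym, hy0⟩ := mem_pivots.1 hm.2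
      have h := hC.sum_eq_zero ((M.tension_iff y).2 ⟨hy, fun b hb hlt =>
        hyP b (Finset.mem_filter.2 ⟨hb, hlt.le⟩)⟩)
      rw [Finset.sum_eq_single m, mul_eq_zero, or_iff_left hym, sign_cast_eq_zero_iff] at h
      · exact h hm.1
      · intro f hf hne
        rcases Finset.mem_insert.1 (hsub hf) with rfl | hfp
        · rw [hyP f (Finset.mem_filter.2 ⟨ht, le_rfl⟩), mul_zero]
        · rw [hy0 f (pivots_subset hfp)
            (lt_of_le_of_ne (hmax f (Finset.mem_inter.2 ⟨hf, hfp⟩)) hne), mul_zero]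
      · exact fun h => absurd hm.1 h
    · have hst : ∀ f ∈ C.supp, f = t := fun f hf =>
        (Finset.mem_insert.1 (hsub hf)).resolve_right
          fun hfp => hn ⟨f, Finset.mem_inter.2 ⟨hf, hfp⟩⟩
      obtain ⟨f, hf⟩ := hC.supp_nonempty
      have hft := hst f hf
      subst hft
      have h := hC.sum_eq_zero (M.isTension_dual D ht le_rfl)
      rw [Finset.sum_eq_single f (fun g hg hne => absurd (hst g hg) hne)
        (fun h => absurd hf h), D.self f ht, mul_one, sign_cast_eq_zero_iff] at h
      exact h hf

/-- The edge lost by the objective set is read off a fundamental cycle. -/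
theorem isExchange_of_fundCycle (M : IsMinorAt G T x H t) (ht : t ∈ T) {t' : E}
    (htt : t < t') (ht' : t' ∉ G.pivots (T.filter (· ≤ t))) {C : SignedEdgeSet E}
    (hC : H.IsFundCycle (insert t (G.pivots (T.filter (· ≤ t)))) t' C) {m : E}
    (hm : IsGreatest (↑(G.pivots (T.filter (· ≤ t)) ∩ C.supp) : Set E) m) :
    G.IsExchange (T.filter (· ≤ t)) t' m := by
  have hmem := Finset.mem_inter.1 hm.1
  -- Since `m` is the greatest pivot on the cycle, pairing the cycle with such a `y` leaves only the
  -- terms at `t'` and `m`.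
  have key : ∀ y, G.IsTension y → (∀ b ∈ T.filter (· ≤ t), y b = 0) →
      (∀ e ∈ G.edges, e < m → y e = 0) → y t' + C.sign m * y m = 0 := by
    intro y hy hyP hy0
    have h := hC.1.sum_eq_zero ((M.tension_iff y).2 ⟨hy, fun b hb hlt =>
      hyP b (Finset.mem_filter.2 ⟨hb, hlt.le⟩)⟩)
    have hne : t' ≠ m := fun h => ht' (h ▸ hmem.1)
    rw [← Finset.sum_subset (s₁ := {t', m}), Finset.sum_pair hne,
      sign_cast_eq_one_iff.2 hC.2.1, one_mul] at h
    · exact h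
    · intro f hf
      rcases Finset.mem_insert.1 hf with rfl | hf
      · exact Finset.mem_union_left _ hC.2.1
      · rw [Finset.mem_singleton.1 hf]; exact hmem.2
    · intro f hf hfn
      rw [Finset.mem_insert, Finset.mem_singleton, not_or] at hfn
      rcases Finset.mem_insert.1 ((Finset.mem_insert.1 (hC.2.2 hf)).resolve_left hfn.1) with rfl | h
      · rw [hyP f (Finset.mem_filter.2 ⟨ht, le_rfl⟩), mul_zero]
      · rw [hy0 f (pivots_subset h)
          (lt_of_le_of_ne (hm.2 (Finset.mem_inter.2 ⟨h, hf⟩)) hfn.2), mul_zero]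
  obtain ⟨hme, y, hy, hyP, hym, hy0⟩ := mem_pivots.1 hmem.1
  refine ⟨⟨hme, y, hy, hyP, hym, hy0, fun h => ?_⟩, fun z hz hzP hz0 => ?_⟩
  · have := key y hy hyP hy0
    rw [h, zero_add, mul_eq_zero, or_iff_left hym, sign_cast_eq_zero_iff] at this
    exact this hmem.2
  · have := key z hz hzP fun e he hlt => hz0 e he hlt.le
    rwa [hz0 m hme le_rfl, mul_zero, add_zero] at this

end IsMinorAt

end Dual

end MultiDigraph

/-! ### The optimal cocycle at a state of the algorithm -/

namespace OptimizableDigraph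

open MultiDigraph

variable {V E : Type*} [LinearOrder E] {G : MultiDigraph V E} {p : E} {T : Finset E}
  {x : E → E → ℝ} {S S' : OptimizableDigraph V E} {C C' : SignedEdgeSet E} {t t' : E}

theorem CocycleLT.asymm (h : S.CocycleLT C C') : ¬ S.CocycleLT C' C := by
  rintro ⟨g, hg, hlt, heq⟩
  obtain ⟨f, hf, hlt', heq'⟩ := h
  rcases lt_trichotomy f g with h | rfl | h
  · exact hlt'.ne (heq f hf h).symm
  · exact lt_asymm hlt hlt'
  · exact hlt.ne (heq' g hg h).symm

theorem IsOptimalCocycle.unique (h : S.IsOptimalCocycle C) (h' : S.IsOptimalCocycle C') :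
    C = C' := by
  by_contra hne
  exact (h.2 C' h'.1 (Ne.symm hne)).asymm (h'.2 C h.1 hne)

/-- `S` is the state of the algorithm in which `t` has just been added to the output. -/
structure IsStateAt (G : MultiDigraph V E) (T : Finset E) (x : E → E → ℝ)
    (S : OptimizableDigraph V E) (t : E) : Prop where
  inf_eq : S.inf = t
  mem : t ∈ T
  ground_eq : S.ground = G.dualGround T x t
  obj_eq : S.obj = G.pivots (T.filter (· ≤ t))
  minor : IsMinorAt G T x S.graph t

/-- The heart of the proof: feasible competitors exceed `x t` by a nonnegative combination of the
later dual tensions. All of these start negatively, so no cancellation can make their combination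
start positively. -/
theorem IsStateAt.isOptimalCocycle_signedCut (h : IsStateAt G T x S t)
    (D : G.IsOptimalDual p T x) {R : Set V}
    (hR : ∀ e ∈ G.edges, S.graph.cutTension R e = x t e) :
    S.IsOptimalCocycle (S.graph.signedCut R) := by
  obtain ⟨hinf, ht, hground, hobj, M⟩ := h
  have hsub := M.edges_subset
  have htree := M.isSpanningTree_filter D
  have htt : t ∈ T.filter (t ≤ ·) := Finset.mem_filter.2 ⟨ht, le_rfl⟩
  have hRt : S.graph.cutTension R t = 1 := by rw [hR t (D.mem_edges ht), D.self t ht]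
  have hR0 : ∀ b ∈ T.filter (t ≤ ·), b ≠ t → S.graph.cutTension R b = 0 := fun b hb hne => by
    have hb := (Finset.mem_filter.1 hb).1
    rw [hR b (D.mem_edges hb), D.other t ht b hb hne]
  have hnn : ∀ e ∈ S.ground, x t e = 1 ∨ x t e = 0 := fun e he =>
    D.nonneg_on_ground ht (hground ▸ he)
  refine ⟨⟨isSignedCocycle_signedCut htree.1 (fun y hy => htree.eq_zero hy) htt
    (by rw [hRt]; norm_num) hR0, ?_, ?_, ?_⟩, ?_⟩
  · rw [hinf]
    exact mem_cutOut.2 ⟨htree.1 htt, hRt⟩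
  · have hcut : (S.graph.signedCut R).supp ∩ S.ground =
        (S.graph.restrict S.ground).cutOut R ∪ (S.graph.restrict S.ground).cutIn R := by
      ext e
      rw [mem_cut, Finset.mem_inter]
      change e ∈ S.graph.cutOut R ∪ S.graph.cutIn R ∧ _ ↔
        e ∈ S.graph.edges ∩ S.ground ∧ S.graph.cutTension R e ≠ 0
      rw [mem_cut, Finset.mem_inter]
      tauto
    rw [hcut]
    refine isCocycle_of_cutTension (G := S.graph.restrict S.ground)
      (T := T.filter (t ≤ ·)) (fun b hb => ?_)
      (fun y hy h0 e he => htree.eq_zero hy h0 e (Finset.mem_inter.1 he).1) htt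
      (by rw [cutTension_restrict, hRt]; norm_num) hR0
    obtain ⟨hbT, hle⟩ := Finset.mem_filter.1 hb
    exact Finset.mem_inter.2 ⟨htree.1 hb, hground ▸ D.mem_ground hbT hle⟩
  · intro e he
    obtain ⟨hes, heg⟩ := Finset.mem_inter.1 he
    obtain ⟨hee, hne⟩ := mem_cut.1 hes
    rw [hR e (hsub hee)] at hne
    exact mem_cutOut.2 ⟨hee, by rw [hR e (hsub hee)]; exact (hnn e heg).resolve_right hne⟩
  · rintro D' ⟨⟨-, R', hpos, hneg⟩, hinfD, -, hD'⟩ hne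
    have hs' : ∀ {e}, e ∈ S.graph.edges → (D'.sign e : ℝ) = S.graph.cutTension R' e :=
      fun he => sign_eq_cutTension hpos hneg he
    have hs : ∀ {e}, e ∈ S.graph.edges → ((S.graph.signedCut R).sign e : ℝ) = x t e :=
      fun he => by rw [sign_eq_cutTension (S := R) rfl rfl he, hR _ (hsub he)]
    set y := S.graph.cutTension R' with hydef
    have hyT : S.graph.IsTension y := isTension_cutTension R'
    obtain ⟨hyG, hy0⟩ := (M.tension_iff y).1 hyT
    have hyt : y t = 1 := by
      rw [← hs' (htree.1 htt), sign_cast_eq_one_iff, ← hinf]; exact hinfD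
    have hynn : ∀ b ∈ T, 0 ≤ y b := by
      intro b hb
      rcases lt_or_ge b t with hlt | hle
      · rw [hy0 b hb hlt]
      · have hbg := D.mem_ground hb hle
        rw [← hs' (M.ground_subset hbg)]
        by_cases hbD : b ∈ D'.supp
        · rw [sign_cast_eq_one_iff.2 (hD' (Finset.mem_inter.2 ⟨hbD, hground ▸ hbg⟩))]
          norm_num
        · rw [sign_cast_eq_zero_iff.2 hbD]
    let z : E → ℝ := fun e => y e - x t e
    have hz : G.IsTension z := hyG.sub (D.tension t ht)
    have hzP : ∀ b ∈ T.filter (· ≤ t), z b = 0 := by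
      intro b hb
      obtain ⟨hb, hle⟩ := Finset.mem_filter.1 hb
      rcases hle.lt_or_eq with hlt | rfl
      · simp only [z, hy0 b hb hlt, D.other t ht b hb hlt.ne, sub_self]
      · simp only [z, hyt, D.self b ht, sub_self]
    have hznn : ∀ b ∈ T, 0 ≤ z b := by
      intro b hb
      by_cases hbt : b = t
      · simp only [z, hbt, hyt, D.self t ht, sub_self, le_refl]
      · simp only [z, D.other t ht b hb hbt, sub_zero]
        exact hynn b hb
    have hzne : ∃ e ∈ S.graph.edges, z e ≠ 0 := by
      by_contra hall
      push Not at hall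
      refine hne (SignedEdgeSet.ext_sign fun e => ?_)
      by_cases he : e ∈ S.graph.edges
      · have := hall e he
        rw [← Int.cast_inj (α := ℝ), hs' he, hs he]
        exact sub_eq_zero.1 this
      · rw [SignedEdgeSet.sign_eq_zero_iff.2 fun h => he (supp_subset_of_cut hpos hneg h),
          SignedEdgeSet.sign_eq_zero_iff.2 fun h =>
            he (supp_subset_of_cut (G := S.graph) (S := R) rfl rfl h)]
    obtain ⟨a, ha, haz, ha0⟩ := exists_pivot hz hzP
      (hzne.imp fun e he => ⟨hsub he.1, he.2⟩)
    have hae : a ∈ S.graph.edges := M.pivots_subset_edges ha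
    -- In the expansion of `z` along `T`, consider the earliest edge at which a tension with nonzero
    -- coefficient starts. Up to there every term is nonpositive, and at that edge the sum is
    -- negative; so the first nonzero value of `z` occurs no later and is negative.
    have hneg' : z a < 0 := by
      refine lt_of_le_of_ne ?_ haz
      rw [D.expand hz (hsub hae)]
      have hfirst : ∀ b ∈ T, z b ≠ 0 → ∃ c ∈ G.edges, x b c = -1 ∧
          ∀ e ∈ G.edges, e < c → x b e = 0 := fun b hb hzb => by
        refine D.internal b hb ?_
        rintro rfl
        exact hzb (hzP b (Finset.mem_filter.2 ⟨hb, D.le_of_mem ht⟩))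
      by_contra hpos
      obtain ⟨b₀, hb₀, hlt₀⟩ := Finset.exists_lt_of_sum_lt
        (f := fun _ => (0 : ℝ)) (by simpa using not_le.1 hpos)
      classical
      let J := T.filter fun b => z b ≠ 0
      choose! c hcE hc hc0 using hfirst
      have hb₀z : z b₀ ≠ 0 := fun h => by
        rw [h, zero_mul] at hlt₀
        exact lt_irrefl _ hlt₀
      obtain ⟨b₁, hb₁, hmin⟩ := J.exists_min_image c ⟨b₀, Finset.mem_filter.2 ⟨hb₀, hb₀z⟩⟩
      obtain ⟨hb₁T, hb₁z⟩ := Finset.mem_filter.1 hb₁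
      have hterm : ∀ b ∈ T, ∀ e ∈ G.edges, e ≤ c b₁ → z b * x b e ≤ 0 := by
        intro b hb e he hle
        by_cases hzb : z b = 0
        · rw [hzb, zero_mul]
        · rcases (hle.trans (hmin b (Finset.mem_filter.2 ⟨hb, hzb⟩))).lt_or_eq with hlt | rfl
          · rw [hc0 b hb hzb e he hlt, mul_zero]
          · rw [hc b hb hzb]; linarith [hznn b hb]
      have hca : a ≤ c b₁ := by
        by_contra hlt
        have h0 := ha0 _ (hcE b₁ hb₁T hb₁z) (not_le.1 hlt)
        rw [D.expand hz (hcE b₁ hb₁T hb₁z)] at h0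
        refine absurd h0 (Finset.sum_neg' (fun b hb => hterm b hb _ (hcE b₁ hb₁T hb₁z) le_rfl)
          ⟨b₁, hb₁T, ?_⟩).ne
        rw [hc b₁ hb₁T hb₁z]
        linarith [lt_of_le_of_ne (hznn b₁ hb₁T) (Ne.symm hb₁z)]
      exact absurd hlt₀ (not_lt.2 (hterm b₀ hb₀ a (hsub hae) hca))
    refine ⟨a, hobj ▸ ha, ?_, fun g hg hlt => ?_⟩
    · rw [← Int.cast_lt (R := ℝ), hs' hae, hs hae]
      exact sub_neg.1 hneg'
    · rw [hobj] at hg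
      have hge := M.pivots_subset_edges hg
      rw [← Int.cast_inj (α := ℝ), hs' hge, hs hge]
      exact sub_eq_zero.1 (ha0 g (hsub hge) hlt)

/-- The tree edges from `t` on span the minor, and the fundamental cut of `t` there has the same
tree values as `x t`. A vertex set in the minor is needed because contraction changes the vertices.
-/
theorem IsStateAt.exists_cutTension_eq (h : IsStateAt G T x S t) (D : G.IsOptimalDual p T x) :
    ∃ R : Set V, ∀ e ∈ G.edges, S.graph.cutTension R e = x t e := by
  have htt : t ∈ T.filter (t ≤ ·) := Finset.mem_filter.2 ⟨h.mem, le_rfl⟩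
  obtain ⟨R, hR1, hR0⟩ := (h.minor.isSpanningTree_filter D).exists_cut htt
  refine ⟨R, fun e he => ?_⟩
  rw [← sub_eq_zero]
  refine h.minor.eq_zero D ((isTension_cutTension R).sub (h.minor.isTension_dual D h.mem le_rfl))
    (fun b hb => ?_) e he
  by_cases hbt : b = t
  · rw [hbt, hR1, D.self t h.mem, sub_self]
  · rw [hR0 b hb hbt, D.other t h.mem b (Finset.mem_filter.1 hb).1 hbt, sub_self]

theorem IsStateAt.exists_isOptimalCocycle (h : IsStateAt G T x S t) (D : G.IsOptimalDual p T x) :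
    ∃ C, S.IsOptimalCocycle C := by
  obtain ⟨R, hR⟩ := h.exists_cutTension_eq D
  exact ⟨_, h.isOptimalCocycle_signedCut D hR⟩

theorem IsStateAt.sign_eq (h : IsStateAt G T x S t) (D : G.IsOptimalDual p T x)
    (hC : S.IsOptimalCocycle C) {e : E} (he : e ∈ S.graph.edges) : (C.sign e : ℝ) = x t e := by
  obtain ⟨R, hR⟩ := h.exists_cutTension_eq D
  rw [hC.unique (h.isOptimalCocycle_signedCut D hR), sign_eq_cutTension (S := R) rfl rfl he,
    hR e (h.minor.edges_subset he)]

/-! ### One step of the algorithm -/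

/-- `t'` is the successor of `t` in `T`. -/
def IsNext (T : Finset E) (t t' : E) : Prop :=
  t' ∈ T ∧ t < t' ∧ ∀ b ∈ T, b < t' → b ≤ t

theorem IsNext.filter_le (h : IsNext T t t') :
    T.filter (· ≤ t') = insert t' (T.filter (· ≤ t)) := by
  ext b
  simp only [Finset.mem_filter, Finset.mem_insert]
  constructor
  · rintro ⟨hb, hle⟩
    rcases hle.lt_or_eq with hlt | rfl
    · exact Or.inr ⟨hb, h.2.2 b hb hlt⟩
    · exact Or.inl rfl
  · rintro (rfl | ⟨hb, hle⟩)
    · exact ⟨h.1, le_rfl⟩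
    · exact ⟨hb, hle.trans h.2.1.le⟩

theorem IsNext.filter_lt (h : IsNext T t t') : T.filter (· < t') = T.filter (· ≤ t) := by
  ext b
  simp only [Finset.mem_filter]
  exact ⟨fun hb => ⟨hb.1, h.2.2 b hb.1 hb.2⟩, fun hb => ⟨hb.1, hb.2.trans_lt h.2.1⟩⟩

theorem exists_isNext (h : ∃ b ∈ T, t < b) : ∃ t', IsNext T t t' := by
  have hn : (T.filter (t < ·)).Nonempty := by
    obtain ⟨b, hb, hlt⟩ := h
    exact ⟨b, Finset.mem_filter.2 ⟨hb, hlt⟩⟩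
  obtain ⟨h1, h2⟩ := Finset.mem_filter.1 (Finset.min'_mem _ hn)
  refine ⟨_, h1, h2, fun b hb hlt => ?_⟩
  by_contra hle
  exact absurd (Finset.min'_le _ b (Finset.mem_filter.2 ⟨hb, not_le.1 hle⟩)) (not_le.2 hlt)

theorem IsNext.mem_dualGround_iff (h : IsNext T t t') (ht : t ∈ T) {e : E} :
    e ∈ G.dualGround T x t' ↔ e ∈ G.dualGround T x t ∧ x t e = 0 := by
  rw [mem_dualGround, mem_dualGround]
  constructor
  · rintro ⟨he, h0⟩
    exact ⟨⟨he, fun b hb hlt => h0 b hb (hlt.trans h.2.1)⟩, h0 t ht h.2.1⟩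
  · rintro ⟨⟨he, h0⟩, hte⟩
    refine ⟨he, fun b hb hlt => ?_⟩
    rcases (h.2.2 b hb hlt).lt_or_eq with hlt' | rfl
    · exact h0 b hb hlt'
    · exact hte

theorem IsStateAt.ground_sdiff (h : IsStateAt G T x S t) (D : G.IsOptimalDual p T x)
    (hC : S.IsOptimalCocycle C) (hn : IsNext T t t') :
    S.ground \ C.supp = G.dualGround T x t' := by
  ext e
  rw [Finset.mem_sdiff, hn.mem_dualGround_iff h.mem, h.ground_eq]
  refine and_congr_right fun he => ?_
  rw [← sign_cast_eq_zero_iff, h.sign_eq D hC (h.minor.ground_subset he)]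

theorem IsStateAt.exists_isExchange (h : IsStateAt G T x S t) (D : G.IsOptimalDual p T x)
    (hn : IsNext T t t') : ∃ m, G.IsExchange (T.filter (· ≤ t)) t' m ∧
      (t' ∈ S.obj → m = t') ∧ (t' ∉ S.obj → ∃ C, S.graph.IsFundCycle (insert S.inf S.obj) t' C ∧
        IsGreatest (↑(S.obj ∩ C.supp) : Set E) m) := by
  obtain ⟨hinf, ht, -, hobj, M⟩ := h
  rw [hinf, hobj]
  by_cases ht' : t' ∈ G.pivots (T.filter (· ≤ t))
  · exact ⟨t', isExchange_self ht', fun _ => rfl, fun h => absurd ht' h⟩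
  · have htE : t' ∈ S.graph.edges := M.ground_subset (D.mem_ground hn.1 hn.2.1.le)
    obtain ⟨C, hC⟩ := (M.isSpanningTree_pivots D ht).exists_fundCycle htE
      (by rw [Finset.mem_insert, not_or]; exact ⟨hn.2.1.ne', ht'⟩)
    have hne : (G.pivots (T.filter (· ≤ t)) ∩ C.supp).Nonempty := by
      -- Without pivots the cycle would consist of `t'` and at most `t`, and pairing it with `x t'`
      -- would give 1 instead of 0.
      by_contra hempty
      have hs := hC.1.sum_eq_zero (M.isTension_dual D hn.1 hn.2.1.le)
      have ht'C : t' ∈ C.supp := Finset.mem_union_left _ hC.2.1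
      rw [Finset.sum_eq_single t' (fun f hf hft => ?_) (fun h => absurd ht'C h),
        D.self t' hn.1, mul_one, sign_cast_eq_zero_iff] at hs
      · exact hs ht'C
      · rcases Finset.mem_insert.1 ((Finset.mem_insert.1 (hC.2.2 hf)).resolve_left hft) with rfl | h
        · rw [D.other t' hn.1 f ht hft, mul_zero]
        · exact absurd ⟨f, Finset.mem_inter.2 ⟨h, hf⟩⟩ hempty
    have hm := Finset.isGreatest_max' _ hne
    exact ⟨_, M.isExchange_of_fundCycle ht hn.2.1 ht' hC hm, fun h => absurd h ht',
      fun _ => ⟨C, hC, hm⟩⟩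

/-- Deletion does not change tensions and contracting `t` forces the value 0 at `t`, which is
exactly the new condition. Connectedness survives because `t` and all later tree edges are kept. -/
theorem IsStateAt.isMinorAt_nextGraph (h : IsStateAt G T x S t) (D : G.IsOptimalDual p T x)
    (hn : IsNext T t t') {F : Finset E} (hF : F = G.pivots (T.filter (· ≤ t')))
    (hFS : F ⊆ S.obj) : IsMinorAt G T x (S.nextGraph (G.dualGround T x t') F) t' := by
  obtain ⟨hinf, ht, hground, hobj, M⟩ := h
  have hsub : G.dualGround T x t' ∪ F ∪ {t} ⊆ S.graph.edges := by
    refine Finset.union_subset (Finset.union_subset (fun e he => ?_) (fun e he => ?_)) ?_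
    · exact M.ground_subset ((hn.mem_dualGround_iff ht).1 he).1
    · exact M.pivots_subset_edges (hobj ▸ hFS he)
    · exact Finset.singleton_subset_iff.2 (M.ground_subset (D.mem_ground ht le_rfl))
  unfold nextGraph
  rw [hinf]
  refine ⟨(M.connected.restrict hsub fun y hy h0 e he => ?_).contract t, ?_, fun y => ?_⟩
  · refine M.eq_zero D hy (fun b hb => h0 b ?_) e (M.edges_subset he)
    obtain ⟨hb, hle⟩ := Finset.mem_filter.1 hb
    rcases hle.lt_or_eq with hlt | rfl
    · refine Finset.mem_union_left _ (Finset.mem_union_left _ (D.mem_ground hb ?_))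
      by_contra hlt'
      exact absurd (hn.2.2 b hb (not_le.1 hlt')) (not_le.2 hlt)
    · exact Finset.mem_union_right _ (Finset.mem_singleton_self _)
  · change (S.graph.edges ∩ (G.dualGround T x t' ∪ F ∪ {t})).erase t = _
    rw [Finset.inter_eq_right.2 hsub, ← hF, Finset.union_comm _ {t}, ← Finset.insert_eq,
      Finset.erase_insert]
    rw [Finset.mem_union, not_or]
    constructor
    · intro hmem
      have := ((hn.mem_dualGround_iff ht).1 hmem).2
      rw [D.self t ht] at this
      norm_num at this
    · rw [hF]
      exact notMem_pivots (Finset.mem_filter.2 ⟨ht, hn.2.1.le⟩)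
  · rw [isTension_contract, isTension_restrict, M.tension_iff, and_assoc]
    refine and_congr_right fun _ => ⟨fun ⟨h0, h1⟩ b hb hlt => ?_, fun h0 => ⟨fun b hb hlt =>
      h0 b hb (hlt.trans hn.2.1), h0 t ht hn.2.1⟩⟩
    rcases (hn.2.2 b hb hlt).lt_or_eq with hlt' | rfl
    · exact h0 b hb hlt'
    · exact h1

/-- An edge that survives removal of the cocycle has its first nonzero dual entry at some tree edge
`b` with `t < b ≤ e`; hence the least surviving edge is the successor of `t`. -/
theorem IsStateAt.next (h : IsStateAt G T x S t) (D : G.IsOptimalDual p T x)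
    (hstep : S.IsStep C S') : ∃ t' m, IsNext T t t' ∧ IsStateAt G T x S' t' ∧
      G.IsExchange (T.filter (· ≤ t)) t' m ∧ S'.obj = S.obj.erase m := by
  obtain ⟨hC, hinf, hground, hobj1, hobj2, hgraph⟩ := hstep
  have hmemT : ∀ {e}, e ∈ S.ground \ C.supp → ∃ b ∈ T, t < b ∧ b ≤ e := by
    intro e he
    obtain ⟨heg, heC⟩ := Finset.mem_sdiff.1 he
    rw [h.ground_eq] at heg
    rw [← sign_cast_eq_zero_iff, h.sign_eq D hC (h.minor.ground_subset heg)] at heC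
    obtain ⟨b, hb, htb, hbe, h1, -⟩ := D.exists_of_mem_ground heg
    refine ⟨b, hb, lt_of_le_of_ne htb ?_, hbe⟩
    rintro rfl
    rw [heC] at h1
    norm_num at h1
  obtain ⟨b, hb, htb, -⟩ := hmemT hinf.1
  obtain ⟨t', hn⟩ := exists_isNext ⟨b, hb, htb⟩
  have hg := h.ground_sdiff D hC hn
  rw [hg] at hinf hground
  have hinf' : S'.inf = t' := hinf.unique (D.isLeast_ground hn.1)
  rw [hinf'] at hobj1 hobj2
  obtain ⟨m, hm, hobj⟩ : ∃ m, G.IsExchange (T.filter (· ≤ t)) t' m ∧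
      S'.obj = S.obj.erase m := by
    by_cases ht' : t' ∈ S.obj
    · exact ⟨t', isExchange_self (h.obj_eq ▸ ht'), hobj1 ht'⟩
    · obtain ⟨Z, hZ, m, hm, hobj⟩ := hobj2 ht'
      rw [h.obj_eq] at ht' hm
      rw [h.inf_eq, h.obj_eq] at hZ
      exact ⟨m, h.minor.isExchange_of_fundCycle h.mem hn.2.1 ht' hZ hm, hobj⟩
  have hobj' : S'.obj = G.pivots (T.filter (· ≤ t')) := by
    rw [hobj, h.obj_eq, hn.filter_le, hm.pivots_insert]
  refine ⟨t', m, hn, ⟨hinf', hn.1, hground, hobj', ?_⟩, hm, hobj⟩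
  rw [hgraph, hground]
  exact h.isMinorAt_nextGraph D hn hobj' (hobj ▸ Finset.erase_subset _ _)

/-- The state of the algorithm at `t` built from the corresponding minor. -/
noncomputable def ofMinor (D : G.IsOptimalDual p T x) (ht : t ∈ T) {H : MultiDigraph V E}
    (M : IsMinorAt G T x H t) : OptimizableDigraph V E where
  graph := H
  inf := t
  ground := G.dualGround T x t
  obj := G.pivots (T.filter (· ≤ t))
  edges_eq := M.edges_eq
  connected := M.connected
  inf_mem := Finset.mem_sdiff.2 ⟨D.mem_ground ht le_rfl,
    notMem_pivots (Finset.mem_filter.2 ⟨ht, le_rfl⟩)⟩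
  acyclic := M.acyclic D
  spanning := M.isSpanningTree_pivots D ht

theorem IsStateAt.exists_step (h : IsStateAt G T x S t) (D : G.IsOptimalDual p T x)
    (hn : IsNext T t t') : ∃ C S', S.IsStep C S' := by
  obtain ⟨C, hC⟩ := h.exists_isOptimalCocycle D
  obtain ⟨m, hm, hm1, hm2⟩ := h.exists_isExchange D hn
  have hobj : G.pivots (T.filter (· ≤ t')) = S.obj.erase m := by
    rw [h.obj_eq, hn.filter_le, hm.pivots_insert]
  have hg := h.ground_sdiff D hC hn
  refine ⟨C, ofMinor D hn.1 (h.isMinorAt_nextGraph D hn rfl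
    (hobj ▸ Finset.erase_subset _ _)), hC, ?_, hg.symm, fun ht' => ?_, fun ht' => ?_, rfl⟩
  · rw [hg]
    exact D.isLeast_ground hn.1
  · exact hobj.trans (congr_arg _ (hm1 ht'))
  · obtain ⟨Z, hZ, hZm⟩ := hm2 ht'
    exact ⟨Z, hZ, m, hZm, hobj⟩

/-! ### The initial state -/

theorem isMinorAt_self (D : G.IsOptimalDual p T x) : IsMinorAt G T x G p := by
  have hlt : ∀ b ∈ T, ¬ b < p := fun b hb => not_lt.2 (D.le_of_mem hb)
  refine ⟨D.tree.connected, ?_, fun y => ⟨fun hy => ⟨hy, fun b hb h => absurd h (hlt b hb)⟩,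
    fun h => h.1⟩⟩
  refine (Finset.union_eq_left.2 ?_).symm.trans (congr_arg (· ∪ _) ?_)
  · exact pivots_subset
  · ext e
    rw [mem_dualGround]
    exact ⟨fun he => ⟨he, fun b hb h => absurd h (hlt b hb)⟩, fun h => h.1⟩

theorem dualGround_min (D : G.IsOptimalDual p T x) : G.dualGround T x p = G.edges := by
  ext e
  rw [mem_dualGround]
  exact ⟨fun h => h.1, fun he => ⟨he, fun b hb h => absurd h (not_lt.2 (D.le_of_mem hb))⟩⟩

theorem filter_le_min (D : G.IsOptimalDual p T x) : T.filter (· ≤ p) = {p} := by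
  ext b
  rw [Finset.mem_filter, Finset.mem_singleton]
  constructor
  · rintro ⟨hb, hle⟩
    exact le_antisymm hle (D.le_of_mem hb)
  · rintro rfl
    exact ⟨D.min_mem, le_rfl⟩

/-- As the least edge, `p` is a pivot of the full tension space (witness `x p`), and requiring the
value 0 at `p` loses just this pivot. -/
theorem isLexMinSpanningTree_iff_eq_pivots (D : G.IsOptimalDual p T x) {B : Finset E} :
    G.IsLexMinSpanningTree B ↔ B = insert p (G.pivots {p}) := by
  have hB := (isMinorAt_self D).isSpanningTree_pivots D D.min_mem
  rw [filter_le_min D] at hB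
  refine isLexMinSpanningTree_iff hB ?_
  have hp : p ∈ G.pivots ∅ := mem_pivots.2 ⟨D.isLeast.1, x p, D.tension p D.min_mem, by simp,
    by rw [D.self p D.min_mem]; norm_num, fun e he hlt => absurd hlt (not_lt.2 (D.isLeast.2 he))⟩
  have := (isExchange_self hp).pivots_insert
  rw [insert_empty_eq] at this
  rw [this, Finset.insert_erase hp]

theorem isInitial_ofMinor (D : G.IsOptimalDual p T x) :
    (ofMinor D D.min_mem (isMinorAt_self D)).IsInitial G p := by
  refine ⟨rfl, rfl, dualGround_min D, _, (isLexMinSpanningTree_iff_eq_pivots D).2 rfl,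
    Finset.mem_insert_self _ _, ?_⟩
  rw [Finset.erase_insert (notMem_pivots (Finset.mem_singleton_self p)), ← filter_le_min D]
  rfl

theorem IsInitial.isStateAt (D : G.IsOptimalDual p T x) (h : S.IsInitial G p) :
    IsStateAt G T x S p := by
  obtain ⟨hgraph, hinf, hground, B, hB, -, hobj⟩ := h
  rw [isLexMinSpanningTree_iff_eq_pivots D] at hB
  refine ⟨hinf, D.min_mem, by rw [hground, dualGround_min D], ?_, by rw [hgraph]; exact isMinorAt_self D⟩
  rw [hobj, hB, Finset.erase_insert (notMem_pivots (Finset.mem_singleton_self p)),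
    filter_le_min D]

/-- The edge that leaves the objective set is the greatest one that can be exchanged. -/
theorem IsStateAt.isGreatest_exchange (h : IsStateAt G T x S t) (D : G.IsOptimalDual p T x)
    (hn : IsNext T t t') (h' : IsStateAt G T x S' t') (hgraph : S'.graph =
      S.nextGraph S'.ground S'.obj) {m : E} (hm : G.IsExchange (T.filter (· ≤ t)) t' m)
    (hobj : S'.obj = S.obj.erase m) :
    IsGreatest {f | f ∈ S.obj ∧ S'.inf ∉ S.obj.erase f ∧
      (S.nextGraph S'.ground (S.obj.erase f)).IsSpanningTree
        (insert S'.inf (S.obj.erase f))} m := by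
  constructor
  · refine ⟨h.obj_eq ▸ hm.mem, ?_, ?_⟩
    · rw [← hobj]
      exact (Finset.mem_sdiff.1 S'.inf_mem).2
    · rw [← hobj, ← hgraph]
      exact S'.spanning
  · rintro f ⟨hf, -, hspan⟩
    by_contra hlt
    rw [not_le] at hlt
    have hf' := hf
    rw [h.obj_eq] at hf'
    obtain ⟨R, hR1, hR0⟩ := S.spanning.exists_cut (Finset.mem_insert_of_mem hf)
    have hinf := h.inf_eq
    have hft : f ≠ t := by
      have htP : t ∈ T.filter (· ≤ t) := Finset.mem_filter.2 ⟨h.mem, le_rfl⟩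
      intro hft
      rw [hft] at hf'
      exact notMem_pivots htP hf'
    set y := S.graph.cutTension R
    have hyH : S.graph.IsTension y := isTension_cutTension R
    obtain ⟨hyG, hy0⟩ := (h.minor.tension_iff y).1 hyH
    have hyt : y t = 0 := hR0 t (hinf ▸ Finset.mem_insert_self _ _) hft.symm
    have hyP : ∀ b ∈ T.filter (· ≤ t), y b = 0 := by
      intro b hb
      obtain ⟨hb, hle⟩ := Finset.mem_filter.1 hb
      rcases hle.lt_or_eq with hlt' | rfl
      · exact hy0 b hb hlt'
      · exact hyt
    have hfE := pivots_subset hf'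
    obtain ⟨a, ha, hya, ha0⟩ := exists_pivot hyG hyP ⟨f, hfE, by rw [hR1]; norm_num⟩
    -- The pivot of `y` lies in the objective set, where `y` vanishes except at `f`. So `y` starts
    -- at `f > m`, and the exchange property forces `y t' = 0`; `y` then vanishes on the supposed
    -- spanning tree although it is not 0.
    have haf : a = f := by
      by_contra hne
      exact hya (hR0 a (Finset.mem_insert_of_mem (h.obj_eq ▸ ha)) hne)
    subst haf
    have hyt' : y t' = 0 := hm.2 y hyG hyP fun e he hle => ha0 e he (hle.trans_lt hlt)
    have hyN : (S.nextGraph S'.ground (S.obj.erase a)).IsTension y := by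
      unfold nextGraph
      rw [isTension_contract, isTension_restrict, hinf]
      exact ⟨hyH, hyt⟩
    have hzero := hspan.eq_zero hyN (fun b hb => by
      rcases Finset.mem_insert.1 hb with rfl | hb
      · rw [h'.inf_eq]; exact hyt'
      · obtain ⟨hne, hb⟩ := Finset.mem_erase.1 hb
        exact hR0 b (Finset.mem_insert_of_mem hb) hne)
    refine hya (h.minor.eq_zero D hyH (fun b hb => ?_) a hfE)
    obtain ⟨hb, hle⟩ := Finset.mem_filter.1 hb
    rcases hle.lt_or_eq with hlt' | rfl
    · refine hzero b (Finset.mem_erase.2 ⟨by rw [hinf]; exact hlt'.ne', Finset.mem_inter.2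
        ⟨h.minor.ground_subset (D.mem_ground hb hle), ?_⟩⟩)
      refine Finset.mem_union_left _ (Finset.mem_union_left _ ?_)
      rw [h'.ground_eq]
      refine D.mem_ground hb ?_
      by_contra hlt''
      exact absurd (hn.2.2 b hb (not_le.1 hlt'')) (not_le.2 hlt')
    · exact hyt

/-! ### Whole runs, indexed by the number of smaller tree edges -/

theorem card_filter_lt_next (ht : t ∈ T) (hn : IsNext T t t') :
    (T.filter (· < t')).card = (T.filter (· < t)).card + 1 := by
  rw [hn.filter_lt, ← Finset.card_insert_of_notMem (a := t) (s := T.filter (· < t)) (by simp)]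
  congr 1
  ext b
  simp only [Finset.mem_filter, Finset.mem_insert]
  constructor
  · rintro ⟨hb, hle⟩
    exact hle.eq_or_lt.imp id fun h => ⟨hb, h⟩
  · rintro (rfl | ⟨hb, hlt⟩)
    · exact ⟨ht, le_rfl⟩
    · exact ⟨hb, hlt.le⟩

theorem exists_gt_of_card_filter_lt (hc : (T.filter (· < t)).card + 1 < T.card) :
    ∃ b ∈ T, t < b := by
  by_contra hall
  push Not at hall
  have : T ⊆ insert t (T.filter (· < t)) := fun b hb =>
    Finset.mem_insert.2 ((hall b hb).eq_or_lt.imp id fun h => Finset.mem_filter.2 ⟨hb, h⟩)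
  have h1 := Finset.card_le_card this
  rw [Finset.card_insert_of_notMem (by simp)] at h1
  omega

theorem exists_isRun (D : G.IsOptimalDual p T x) : ∃ S C, IsRun G p T.card S C := by
  classical
  let S₁ := ofMinor D D.min_mem (isMinorAt_self D)
  let nxt : OptimizableDigraph V E → OptimizableDigraph V E := fun S =>
    if h : ∃ S', ∃ C, S.IsStep C S' then h.choose else S
  -- Runs are indexed from 1; by truncated subtraction the irrelevant index 0 repeats the initial
  -- state.
  let S : ℕ → OptimizableDigraph V E := fun i => nxt^[i - 1] S₁
  have hS1 : (S 1).IsInitial G p := isInitial_ofMinor D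
  have hSs : ∀ i, 1 ≤ i → S (i + 1) = nxt (S i) := by
    intro i hi
    obtain ⟨j, rfl⟩ := Nat.exists_eq_add_of_le' hi
    exact Function.iterate_succ_apply' _ _ _
  have hstep : ∀ i, 1 ≤ i → (∃ S' C, (S i).IsStep C S') → ∃ C, (S i).IsStep C (S (i + 1)) := by
    intro i hi h
    rw [hSs i hi]
    simp only [nxt, dif_pos h]
    exact h.choose_spec
  have hinv : ∀ i, 1 ≤ i → i ≤ T.card →
      ∃ t, IsStateAt G T x (S i) t ∧ (T.filter (· < t)).card + 1 = i := by
    intro i hi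
    induction i, hi using Nat.le_induction with
    | base =>
      intro _
      refine ⟨p, hS1.isStateAt D, ?_⟩
      rw [Finset.filter_false_of_mem fun b hb => not_lt.2 (D.le_of_mem hb)]
      rfl
    | succ i hi ih =>
      intro hic
      obtain ⟨t, ht, hcard⟩ := ih (by omega)
      obtain ⟨t', hn⟩ := exists_isNext
        (exists_gt_of_card_filter_lt (T := T) (t := t) (by omega))
      obtain ⟨C, S', hCS⟩ := ht.exists_step D hn
      obtain ⟨C', hC'⟩ := hstep i hi ⟨S', C, hCS⟩
      obtain ⟨t'', m, hn', ht'', -⟩ := ht.next D hC'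
      exact ⟨t'', ht'', by rw [card_filter_lt_next ht.mem hn', hcard]⟩
  have hC : ∀ i, ∃ C, 1 ≤ i → i < T.card → (S i).IsStep C (S (i + 1)) := by
    intro i
    by_cases hi : 1 ≤ i ∧ i < T.card
    · obtain ⟨t, ht, hcard⟩ := hinv i hi.1 hi.2.le
      obtain ⟨t', hn⟩ := exists_isNext
        (exists_gt_of_card_filter_lt (T := T) (t := t) (by omega))
      obtain ⟨C, S', hCS⟩ := ht.exists_step D hn
      obtain ⟨C', hC'⟩ := hstep i hi.1 ⟨S', C, hCS⟩
      exact ⟨C', fun _ _ => hC'⟩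
    · exact ⟨⟨∅, ∅, by simp⟩, fun h1 h2 => absurd ⟨h1, h2⟩ hi⟩
  choose C hC using hC
  exact ⟨S, C, hS1, hC⟩

section Run

variable {S : ℕ → OptimizableDigraph V E} {C : ℕ → SignedEdgeSet E}

theorem IsRun.isStateAt (D : G.IsOptimalDual p T x) (h : IsRun G p T.card S C) {i : ℕ}
    (hi : 1 ≤ i) (hiT : i ≤ T.card) :
    IsStateAt G T x (S i) (S i).inf ∧ (T.filter (· < (S i).inf)).card + 1 = i := by
  induction i, hi using Nat.le_induction with
  | base =>
    have h1 := h.1.isStateAt D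
    rw [h1.inf_eq]
    refine ⟨h1, ?_⟩
    rw [Finset.filter_false_of_mem fun b hb => not_lt.2 (D.le_of_mem hb)]
    rfl
  | succ i hi ih =>
    obtain ⟨ht, hcard⟩ := ih (by omega)
    obtain ⟨t', m, hn, ht', -⟩ := ht.next D (h.2 i hi (by omega))
    rw [ht'.inf_eq]
    exact ⟨ht', by rw [card_filter_lt_next ht.mem hn, hcard]⟩

theorem IsRun.strictMono (D : G.IsOptimalDual p T x) (h : IsRun G p T.card S C) {i j : ℕ}
    (hi : 1 ≤ i) (hij : i < j) (hj : j ≤ T.card) : (S i).inf < (S j).inf := by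
  have h1 := (h.isStateAt D hi (hij.le.trans hj)).2
  have h2 := (h.isStateAt D (hi.trans hij.le) hj).2
  by_contra hle
  rw [not_lt] at hle
  have : T.filter (· < (S j).inf) ⊆ T.filter (· < (S i).inf) := fun b hb => by
    rw [Finset.mem_filter] at hb ⊢
    exact ⟨hb.1, hb.2.trans_le hle⟩
  have := Finset.card_le_card this
  omega

/-- The outputs are distinct elements of `T`, as many as `T` has. Because `IsRun` involves `T` only
through its cardinality, this also yields uniqueness. -/
theorem IsRun.eq_image (D : G.IsOptimalDual p T x) (h : IsRun G p T.card S C) :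
    T = (Finset.Icc 1 T.card).image fun i => (S i).inf := by
  symm
  apply Finset.eq_of_subset_of_card_le
  · intro b hb
    obtain ⟨i, hi, rfl⟩ := Finset.mem_image.1 hb
    rw [Finset.mem_Icc] at hi
    exact (h.isStateAt D hi.1 hi.2).1.mem
  · rw [Finset.card_image_of_injOn, Nat.card_Icc, Nat.add_sub_cancel]
    intro i hi j hj hij
    rw [Finset.coe_Icc, Set.mem_Icc] at hi hj
    rcases lt_trichotomy i j with hlt | heq | hlt
    · exact absurd hij (h.strictMono D hi.1 hlt hj.2).ne
    · exact heq
    · exact absurd hij (h.strictMono D hj.1 hlt hi.2).ne'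

theorem IsRun.mem_iff_of_lt (D : G.IsOptimalDual p T x) (h : IsRun G p T.card S C) {i : ℕ}
    (hi : 1 ≤ i) (hiT : i ≤ T.card) {b : E} :
    b ∈ T ∧ b < (S i).inf ↔ ∃ j, 1 ≤ j ∧ j < i ∧ (S j).inf = b := by
  constructor
  · rintro ⟨hb, hlt⟩
    rw [h.eq_image D] at hb
    obtain ⟨j, hj, rfl⟩ := Finset.mem_image.1 hb
    rw [Finset.mem_Icc] at hj
    refine ⟨j, hj.1, ?_, rfl⟩
    by_contra hle
    rcases (not_lt.1 hle).lt_or_eq with hlt' | rfl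
    · exact lt_asymm hlt (h.strictMono D hi hlt' hj.2)
    · exact lt_irrefl _ hlt
  · rintro ⟨j, hj, hji, rfl⟩
    exact ⟨(h.isStateAt D hj (hji.le.trans hiT)).1.mem, h.strictMono D hj hji hiT⟩

end Run

end OptimizableDigraph

/-! ### The theorem -/

theorem mainTheorem1 {V E : Type*} [LinearOrder E] (G : MultiDigraph V E) (p : E) (r : ℕ)
    (hp : IsLeast (G.edges : Set E) p) (hG : G.IsBipolar p) (hr : G.verts.card = r + 1) :
    -- the fully optimal spanning tree exists and is unique
    ∃ T : Finset E, (∀ T' : Finset E, G.IsFullyOptimal p T' ↔ T' = T) ∧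
      -- the algorithm is well defined
      (∃ S C, OptimizableDigraph.IsRun G p r S C) ∧
      ∀ S C, OptimizableDigraph.IsRun G p r S C →
        -- the optimal cocycles are unique, so that the algorithm is deterministic
        (∀ i, 1 ≤ i → i < r → ∀ D, (S i).IsOptimalCocycle D → D = C i) ∧
        -- the output is the fully optimal spanning tree, listed increasingly
        (∀ i j, 1 ≤ i → i < j → j ≤ r → (S i).inf < (S j).inf) ∧
        T = (Finset.Icc 1 r).image (fun i => (S i).inf) ∧
        -- the optimal cocycles are induced by the fundamental cocycles
        (∀ i, 1 ≤ i → i < r → ∃ D, G.IsFundCocycle T (S i).inf D ∧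
          (C i).pos = D.pos ∩ (S i).graph.edges ∧ (C i).neg = D.neg ∩ (S i).graph.edges) ∧
        -- each new edge is the smallest one outside the previous fundamental cocycles
        (∀ i, 2 ≤ i → i ≤ r → IsLeast {e | e ∈ G.edges ∧ ∀ j, 1 ≤ j → j < i →
          ∃ D, G.IsFundCocycle T (S j).inf D ∧ e ∉ D.supp} (S i).inf) ∧
        -- the equivalent description of the successive objective sets
        (∀ i, 1 ≤ i → i < r → ∃ m,
          IsGreatest {x | x ∈ (S i).obj ∧ (S (i + 1)).inf ∉ (S i).obj.erase x ∧
            ((S i).nextGraph (S (i + 1)).ground ((S i).obj.erase x)).IsSpanningTree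
              (insert (S (i + 1)).inf ((S i).obj.erase x))} m ∧
          (S (i + 1)).obj = (S i).obj.erase m) := by
  obtain ⟨T, hT⟩ := hG.exists_isFullyOptimal hp
  obtain ⟨x, D⟩ := hT.exists_dual hp
  have hcard : ∀ {T' : Finset E}, G.IsSpanningTree T' → T'.card = r := fun hT' => by
    have := hT'.card_eq
    omega
  obtain rfl := hcard hT.1
  obtain ⟨S₀, C₀, hrun₀⟩ := OptimizableDigraph.exists_isRun D
  refine ⟨T, fun T' => ⟨fun hT' => ?_, fun h => h ▸ hT⟩, ⟨S₀, C₀, hrun₀⟩, fun S C hrun => ?_⟩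
  -- The run obtained from `T` is analysed a second time with the dual tensions of `T'`; its output
  -- equals both trees.
  · obtain ⟨x', D'⟩ := hT'.exists_dual hp
    have hc := hcard hT'.1
    rw [hrun₀.eq_image D, ← hc]
    exact OptimizableDigraph.IsRun.eq_image D' (by rwa [hc])
  have hfund : ∀ {b}, b ∈ T → ∃ F, G.IsFundCocycle T b F := fun {b} hb => by
    obtain ⟨R, hR1, hR0⟩ := hT.1.exists_cut hb
    exact ⟨_, hT.1.isFundCocycle_signedCut hb hR1 hR0⟩
  have hsign : ∀ {b F e}, b ∈ T → G.IsFundCocycle T b F → e ∈ G.edges → (F.sign e : ℝ) = x b e :=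
    fun hb hF he => hF.sign_eq hT.1 hb (D.tension _ hb) (D.self _ hb) (D.other _ hb) he
  refine ⟨fun i hi hir F hF => hF.unique (hrun.2 i hi hir).1,
    fun i j hi hij hj => hrun.strictMono D hi hij hj, hrun.eq_image D, fun i hi hir => ?_,
    fun i hi hir => ?_, fun i hi hir => ?_⟩
  · have hs := (hrun.isStateAt D hi hir.le).1
    have hC := (hrun.2 i hi hir).1
    obtain ⟨F, hF⟩ := hfund hs.mem
    have hsupp := hC.1.1.supp_subset
    have key : ∀ e ∈ (S i).graph.edges, (C i).sign e = F.sign e := fun e he => by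
      rw [← Int.cast_inj (α := ℝ), hs.sign_eq D hC he,
        hsign hs.mem hF (hs.minor.edges_subset he)]
    refine ⟨F, hF, ?_, ?_⟩ <;> ext e <;> rw [Finset.mem_inter]
    · constructor
      · intro he
        have hee := hsupp (Finset.mem_union_left _ he)
        exact ⟨SignedEdgeSet.sign_eq_one_iff.1
          ((key e hee).symm.trans (SignedEdgeSet.sign_of_mem_pos he)), hee⟩
      · rintro ⟨he, hee⟩
        exact SignedEdgeSet.sign_eq_one_iff.1
          ((key e hee).trans (SignedEdgeSet.sign_of_mem_pos he))
    · constructor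
      · intro he
        have hee := hsupp (Finset.mem_union_right _ he)
        exact ⟨SignedEdgeSet.sign_eq_neg_one_iff.1
          ((key e hee).symm.trans (SignedEdgeSet.sign_of_mem_neg he)), hee⟩
      · rintro ⟨he, hee⟩
        exact SignedEdgeSet.sign_eq_neg_one_iff.1
          ((key e hee).trans (SignedEdgeSet.sign_of_mem_neg he))
  · have hi1 : 1 ≤ i := by omega
    have hleast := D.isLeast_ground (hrun.isStateAt D hi1 hir).1.mem
    convert hleast using 1
    ext e
    rw [Set.mem_ofPred_eq, Finset.mem_coe, MultiDigraph.mem_dualGround]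
    refine and_congr_right fun he => ⟨fun h b hb hlt => ?_, fun h j hj hji => ?_⟩
    · obtain ⟨j, hj, hji, rfl⟩ := (hrun.mem_iff_of_lt D hi1 hir).1 ⟨hb, hlt⟩
      obtain ⟨F, hF, heF⟩ := h j hj hji
      rw [← hsign hb hF he, MultiDigraph.sign_cast_eq_zero_iff.2 heF]
    · obtain ⟨hb, hlt⟩ := (hrun.mem_iff_of_lt D hi1 hir).2 ⟨j, hj, hji, rfl⟩
      obtain ⟨F, hF⟩ := hfund hb
      refine ⟨F, hF, ?_⟩
      rw [← MultiDigraph.sign_cast_eq_zero_iff, hsign hb hF he]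
      exact h _ hb hlt
  · have hs := (hrun.isStateAt D hi hir.le).1
    have hstep := hrun.2 i hi hir
    obtain ⟨t', m, hn, hs', hm, hobj⟩ := hs.next D hstep
    exact ⟨m, hs.isGreatest_exchange D hn hs' hstep.2.2.2.2.2 hm hobj, hobj⟩
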